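/- Let $\mathcal V$ be a complex vector space and $\mathcal V_{\rm nc}=\coprod_{n\ge 1}\mathcal V^{n\times n}$; for $\Xi\subset\mathcal V_{\rm nc}$ write $\Xi_n=\Xi\cap\mathcal V^{n\times n}$. A set $\Xi\subset\mathcal V_{\rm nc}$ is a *full nc set* if it is closed under direct sums and if $Z\in\Xi_n$, $\widetilde Z\in\mathcal V^{m\times m}$, $J\in\mathbb C^{n\times m}$ injective and $J\widetilde Z=ZJ$ imply $\widetilde Z\in\Xi$; $[\Omega]_{\rm full}$ denotes the smallest full nc set containing $\Omega$. For unital $C^*$-algebras $\mathcal A,\mathcal B$, a *nc kernel* on $\Omega\subset\mathcal V_{\rm nc}$ from $\mathcal A$ to $\mathcal B$ assigns to $Z\in\Omega_n$, $W\in\Omega_m$ a bounded linear map $K(Z,W)\colon\mathcal A^{n\times m}\to\mathcal B^{n\times m}$ such that, for $Z,\widetilde Z,W,\widetilde W\in\Omega$ and complex matrices $\alpha,\beta$ of compatible sizes, $\alpha Z=\widetilde Z\alpha$ and $\beta W=\widetilde W\beta$ imply $\alpha K(Z,W)(P)\beta^*=K(\widetilde Z,\widetilde W)(\alpha P\beta^*)$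 for all $P\in\mathcal A^{n\times m}$. It is *Hermitian* if $K(Z,W)(P)^*=K(W,Z)(P^*)$ always. If $\mathcal B=\mathcal L(\mathcal Y)$ for a complex Hilbert space $\mathcal Y$, a nc kernel $K$ is *completely positive* (cp) if $\sum_{i,j=1}^k\langle K(Z_i,Z_j)(a_i^*a_j)y_j,y_i\rangle\ge 0$ for all $k$, all $Z_i\in\Omega_{n_i}$, all rows $a_i\in\mathcal A^{1\times n_i}$ and all $y_i\in\mathcal Y^{n_i}$ ($1\le i\le k$). A kernel is *decomposable* on a set if it is there the difference of two cp nc kernels. For an operator $T$ on a Hilbert space, $T\succeq 0$ means that $T$ is positive semidefinite, and $T\succ 0$ that $T\succeq\varepsilon I$ for some $\varepsilon>0$. **Theorem 5.1.** Let $\mathcal E$ and $\mathcal N$ be complex Hilbert spaces, let $\Xi\subset\mathcal V_{\rm nc}$ be a full nc set, let $\mathfrak Q$ be a Hermitian nc kernel on $\Xi$ from $\mathbb C$ to $\mathcal L(\mathcal N)$, and put $$\mathbb P_{\mathfrak Q}=\coprod_{n\ge 1}\{Z\in\Xi_n:\ \mathfrak Q(Z,Z)(I_n)\succ 0\}.$$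 Suppose that (i) $\Omega$ is a subset (finite or infinite) of $\mathbb P_{\mathfrak Q}$; (ii) $\mathfrak S$ is a Hermitian nc kernel on $\Omega'=[\Omega]_{\rm full}\cap\mathbb P_{\mathfrak Q}$ from $\mathbb C$ to $\mathcal L(\mathcal E)$ with $\mathfrak S(Z,Z)(I_n)\succeq 0$ for all $n\ge 1$ and $Z\in\Omega'_n$; (iii) the restriction of $\mathfrak Q$ to every finite subset of $\Xi$ is decomposable; (iv) the restriction of $\mathfrak S$ to every finite subset of $\Omega'$ is decomposable. Then there exist cp nc kernels $\Gamma_1$ and $\Gamma_2$ on $\Omega$, the first from $\mathcal L(\mathcal N)$ to $\mathcal L(\mathcal E)$ and the second from $\mathbb C$ to $\mathcal L(\mathcal E)$, such that $$\mathfrak S(Z,W)(P)=\Gamma_1(Z,W)\big(\mathfrak Q(Z,W)(P)\big)+\Gamma_2(Z,W)(P)$$ for all $Z\in\Omega_n$, $W\in\Omega_m$, $P\in\mathbb C^{n\times m}$ and all $n,m\ge 1$. -/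

import Mathlib

open scoped ComplexOrder

namespace NCKernel

/-- A point of the nc space over a vector space `V`: a square matrix, of some size `n ≥ 1`,
with entries in `V`. -/
structure NcPoint (V : Type*) where
  size : ℕ
  size_pos : 0 < size
  mat : Matrix (Fin size) (Fin size) V

/-- The product `α P` of a complex matrix and a matrix with entries in a complex vector space. -/
def mulLeft {M : Type*} [AddCommGroup M] [Module ℂ M] {a b c : ℕ}
    (α : Matrix (Fin a) (Fin b) ℂ) (P : Matrix (Fin b) (Fin c) M) : Matrix (Fin a) (Fin c) M :=
  Matrix.of fun i j => ∑ k, α i k • P k j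

/-- The product `P β` of a matrix with entries in a complex vector space and a complex matrix. -/
def mulRight {M : Type*} [AddCommGroup M] [Module ℂ M] {a b c : ℕ}
    (P : Matrix (Fin a) (Fin b) M) (β : Matrix (Fin b) (Fin c) ℂ) : Matrix (Fin a) (Fin c) M :=
  Matrix.of fun i j => ∑ k, β k j • P i k

section Sets

variable {V : Type*} [AddCommGroup V] [Module ℂ V]

/-- The relation `α Z = Z' α`. -/
def Intertwines (Z Z' : NcPoint V) (α : Matrix (Fin Z'.size) (Fin Z.size) ℂ) : Prop :=
  mulLeft α Z.mat = mulRight Z'.mat α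

/-- The direct sum: the block diagonal matrix with diagonal blocks `Z` and `W`. -/
def NcPoint.directSum (Z W : NcPoint V) : NcPoint V where
  size := Z.size + W.size
  size_pos := Nat.add_pos_left Z.size_pos W.size
  mat := (Matrix.fromBlocks Z.mat 0 0 W.mat).submatrix finSumFinEquiv.symm finSumFinEquiv.symm

/-- A full nc subset: closed under direct sums and invariant under left injective
intertwinings. -/
structure IsFullNcSet (Ξ : Set (NcPoint V)) : Prop where
  directSum_mem : ∀ Z ∈ Ξ, ∀ W ∈ Ξ, Z.directSum W ∈ Ξ
  mem_of_injective : ∀ Z ∈ Ξ, ∀ (Z' : NcPoint V) (J : Matrix (Fin Z.size) (Fin Z'.size) ℂ),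
    Function.Injective J.mulVec → Intertwines Z' Z J → Z' ∈ Ξ

/-- The full nc envelope: the smallest full nc subset containing `Ω`. -/
def fullEnvelope (Ω : Set (NcPoint V)) : Set (NcPoint V) :=
  ⋂₀ {Ξ | IsFullNcSet Ξ ∧ Ω ⊆ Ξ}

end Sets

/-- A graded kernel: to points `Z`, `W` of sizes `n`, `m` it assigns a bounded linear map from
`n × m` matrices over `A` to `n × m` matrices over `B`. A kernel on a set `Ω` of nc points is
represented by such a function, of which only the values at points of `Ω` matter. -/
abbrev GradedKernel (V A B : Type*) [CStarAlgebra A] [CStarAlgebra B] :=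
  (Z W : NcPoint V) → (Matrix (Fin Z.size) (Fin W.size) A →L[ℂ] Matrix (Fin Z.size) (Fin W.size) B)

section Kernels

variable {V : Type*} [AddCommGroup V] [Module ℂ V]
variable {A B : Type*} [CStarAlgebra A] [CStarAlgebra B]
variable {Y : Type*} [NormedAddCommGroup Y] [InnerProductSpace ℂ Y] [CompleteSpace Y]

/-- `K` is a nc kernel on `Ω`: it respects intertwinings between points of `Ω`. -/
def IsNcKernelOn (Ω : Set (NcPoint V)) (K : GradedKernel V A B) : Prop :=
  ∀ Z ∈ Ω, ∀ Z' ∈ Ω, ∀ W ∈ Ω, ∀ W' ∈ Ω,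
    ∀ (α : Matrix (Fin Z'.size) (Fin Z.size) ℂ) (β : Matrix (Fin W'.size) (Fin W.size) ℂ),
      Intertwines Z Z' α → Intertwines W W' β →
        ∀ P : Matrix (Fin Z.size) (Fin W.size) A,
          mulRight (mulLeft α (K Z W P)) β.conjTranspose =
            K Z' W' (mulRight (mulLeft α P) β.conjTranspose)

/-- `K(Z,W)(P)* = K(W,Z)(P*)` for all `Z`, `W` in `Ω`. -/
def IsHermitianOn (Ω : Set (NcPoint V)) (K : GradedKernel V A B) : Prop :=
  ∀ Z ∈ Ω, ∀ W ∈ Ω, ∀ P : Matrix (Fin Z.size) (Fin W.size) A,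
    (K Z W P).conjTranspose = K W Z P.conjTranspose

/-- For a matrix `T` of operators on `Y`, viewed as an operator from `Y^m` to `Y^n`, the number
`⟨T y, x⟩` in `Y^n` (the inner product being linear in the entry `T y`). -/
noncomputable def blockForm {n m : ℕ} (T : Matrix (Fin n) (Fin m) (Y →L[ℂ] Y))
    (x : Fin n → Y) (y : Fin m → Y) : ℂ :=
  ∑ p, ∑ q, inner ℂ (x p) (T p q (y q))

/-- `T ⪰ 0` as an operator on `Y^n`. -/
def BlockNonneg {n : ℕ} (T : Matrix (Fin n) (Fin n) (Y →L[ℂ] Y)) : Prop :=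
  ∀ y : Fin n → Y, 0 ≤ blockForm T y y

/-- `T ≻ 0` as an operator on `Y^n`: `T ⪰ ε I` for some `ε > 0`. -/
def BlockStrictlyPos {n : ℕ} (T : Matrix (Fin n) (Fin n) (Y →L[ℂ] Y)) : Prop :=
  ∃ ε : ℝ, 0 < ε ∧ ∀ y : Fin n → Y, ((ε * ∑ p, ‖y p‖ ^ 2 : ℝ) : ℂ) ≤ blockForm T y y

/-- `K` is a completely positive nc kernel on `Ω`: a nc kernel with
`∑ i j, ⟨K(Z_i, Z_j)(a_i* a_j) y_j, y_i⟩ ≥ 0` for all finite families of points `Z_i` of `Ω`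
(repetitions allowed), rows `a_i` over `A` and columns `y_i` over `Y` of matching lengths. -/
structure IsCPNcKernelOn (Ω : Set (NcPoint V)) (K : GradedKernel V A (Y →L[ℂ] Y)) : Prop where
  isNcKernelOn : IsNcKernelOn Ω K
  nonneg : ∀ (k : ℕ) (Z : Fin k → NcPoint V), (∀ i, Z i ∈ Ω) →
    ∀ (a : ∀ i, Fin (Z i).size → A) (y : ∀ i, Fin (Z i).size → Y),
      0 ≤ ∑ i, ∑ j, blockForm
        (K (Z i) (Z j) (Matrix.of fun p q => star (a i p) * a j q)) (y i) (y j)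

/-- The restriction of `K` to `Ω` is a difference of two completely positive nc kernels. -/
def IsDecomposableOn (Ω : Set (NcPoint V)) (K : GradedKernel V A (Y →L[ℂ] Y)) : Prop :=
  ∃ K₁ K₂ : GradedKernel V A (Y →L[ℂ] Y), IsCPNcKernelOn Ω K₁ ∧ IsCPNcKernelOn Ω K₂ ∧
    ∀ Z ∈ Ω, ∀ W ∈ Ω, K Z W = K₁ Z W - K₂ Z W

/-- The strict positivity domain `{Z ∈ Ξ : Q(Z,Z)(I) ≻ 0}`. -/
def strictPosDomain (Ξ : Set (NcPoint V)) (Q : GradedKernel V ℂ (Y →L[ℂ] Y)) :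
    Set (NcPoint V) :=
  {Z | Z ∈ Ξ ∧ BlockStrictlyPos (Q Z Z 1)}

end Kernels

end NCKernel

open scoped ComplexOrder

set_option linter.unusedSectionVars false

/-! The proof is a cone separation followed by a representation of positive functionals by cp
kernels. Index finitely supported block families `m` by pairs of points of Ω decorated with vectors
`y` from `E`. Call a family accretive if its quadratic form has nonnegative real part at every
choice of vectors. Let `q` apply `Q` to each block, and let `s m` be the form of the blocks `S(Z_k,
Z_l)(m_kl)` at the vectors `y_k` carried by the indices.

If `m` and `q m` are accretive, then `Re s m ≥ 0` (`re_sum_blockForm_nonneg`). Assemble the blocks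
into one matrix `G` over a direct sum `Z₀` of the points. Then `G + G* + 2δ` is positive definite,
say `J J*`, and `Q(Z₀, Z₀)(J J*) ≻ 0` says that the similar point `J⁻¹ Z₀ J` is again in the strict
positivity domain. It lies in the full envelope as well, so `S` is positive there at the identity,
that is, `S(Z₀, Z₀)(J J*) ⪰ 0`. Let `δ → 0`.

The extension theorem of M. Riesz then splits `s` as `Λ₁ ∘ q + Λ₂`, where `Λ₁` and `Λ₂` are positive
on accretive families (`exists_positive_decomposition`). Strict positivity of `Q(Z, Z)(I)` supplies
the dominating elements that the theorem requires.

Finally `Λ₁` and `Λ₂` come from cp kernels (`exists_kernel`). Nothing makes them linear in the index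
vectors or compatible with intertwinings a priori. Both properties, and continuity, follow from a
bound on Gram families inherited from `s`: by Cauchy–Schwarz a functional with this bound sees a
combination of vectors transported to a common point only through its sum (`norm_sq_sum_le`). -/

namespace NCKernel

/-! ### Complex matrices acting on columns and matrices of vectors. -/

section MatrixActions

variable {M : Type*} [AddCommGroup M] [Module ℂ M] {a b c d : ℕ}

/-- The product of a complex matrix and a column of vectors. -/
def act (α : Matrix (Fin a) (Fin b) ℂ) (x : Fin b → M) : Fin a → M :=
  fun p => ∑ k, α p k • x k

theorem act_mul (α : Matrix (Fin a) (Fin b) ℂ) (β : Matrix (Fin b) (Fin c) ℂ) (x : Fin c → M) :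
    act (α * β) x = act α (act β x) := by
  funext p
  simp only [act, Matrix.mul_apply, Finset.sum_smul, Finset.smul_sum, smul_smul]
  exact Finset.sum_comm

@[simp] theorem act_one (x : Fin a → M) : act (1 : Matrix (Fin a) (Fin a) ℂ) x = x := by
  funext p
  simp [act, Matrix.one_apply, ite_smul]

theorem act_smul_one (r : ℂ) (x : Fin a → M) :
    act (r • (1 : Matrix (Fin a) (Fin a) ℂ)) x = r • x := by
  funext p
  simp [act, Matrix.one_apply, ite_smul]

theorem mulRight_mulLeft (α : Matrix (Fin a) (Fin b) ℂ) (P : Matrix (Fin b) (Fin c) M)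
    (β : Matrix (Fin c) (Fin d) ℂ) :
    mulRight (mulLeft α P) β = mulLeft α (mulRight P β) := by
  ext i j
  simp only [mulRight, mulLeft, Matrix.of_apply, Finset.smul_sum, smul_smul]
  rw [Finset.sum_comm]
  simp only [mul_comm]

theorem mulLeft_mulLeft {e : ℕ} (α : Matrix (Fin a) (Fin b) ℂ) (β : Matrix (Fin b) (Fin c) ℂ)
    (P : Matrix (Fin c) (Fin e) M) : mulLeft α (mulLeft β P) = mulLeft (α * β) P := by
  ext i j
  simp only [mulLeft, Matrix.of_apply, Finset.smul_sum, smul_smul, Matrix.mul_apply,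
    Finset.sum_smul]
  exact Finset.sum_comm

theorem mulRight_mulRight {e : ℕ} (P : Matrix (Fin e) (Fin a) M) (α : Matrix (Fin a) (Fin b) ℂ)
    (β : Matrix (Fin b) (Fin c) ℂ) : mulRight (mulRight P α) β = mulRight P (α * β) := by
  ext i j
  simp only [mulRight, Matrix.of_apply, Finset.smul_sum, smul_smul, Matrix.mul_apply,
    Finset.sum_smul]
  rw [Finset.sum_comm]
  simp only [mul_comm]

@[simp] theorem mulLeft_one (P : Matrix (Fin a) (Fin b) M) :
    mulLeft (1 : Matrix (Fin a) (Fin a) ℂ) P = P := by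
  ext i j
  simp [mulLeft, Matrix.one_apply, ite_smul]

@[simp] theorem mulRight_one (P : Matrix (Fin a) (Fin b) M) :
    mulRight P (1 : Matrix (Fin b) (Fin b) ℂ) = P := by
  ext i j
  simp [mulRight, Matrix.one_apply, ite_smul]

theorem mulLeft_smul_one (r : ℂ) (P : Matrix (Fin a) (Fin b) M) :
    mulLeft (r • (1 : Matrix (Fin a) (Fin a) ℂ)) P = r • P := by
  ext i j
  simp [mulLeft, Matrix.one_apply, ite_smul]

theorem mulRight_smul_one (r : ℂ) (P : Matrix (Fin a) (Fin b) M) :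
    mulRight P (r • (1 : Matrix (Fin b) (Fin b) ℂ)) = r • P := by
  ext i j
  simp [mulRight, Matrix.one_apply, ite_smul]

theorem mulRight_sum {ι : Type*} (s : Finset ι) (P : ι → Matrix (Fin a) (Fin b) M)
    (β : Matrix (Fin b) (Fin c) ℂ) :
    mulRight (∑ i ∈ s, P i) β = ∑ i ∈ s, mulRight (P i) β := by
  ext i j
  simp only [mulRight, Matrix.of_apply, Matrix.sum_apply, Finset.smul_sum]
  exact Finset.sum_comm

theorem mulRight_mulLeft_eq_mul (α : Matrix (Fin a) (Fin b) ℂ) (P : Matrix (Fin b) (Fin c) ℂ)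
    (β : Matrix (Fin c) (Fin d) ℂ) : mulRight (mulLeft α P) β = α * P * β := by
  ext i j
  simp [mulRight, mulLeft, Matrix.mul_apply, mul_comm]

theorem mulRight_mulLeft_one {A : Type*} [Ring A] [Algebra ℂ A]
    (α : Matrix (Fin a) (Fin b) ℂ) (β : Matrix (Fin b) (Fin c) ℂ) :
    mulRight (mulLeft α (1 : Matrix (Fin b) (Fin b) A)) β = (α * β).map (algebraMap ℂ A) := by
  ext i j
  simp only [mulRight, mulLeft, Matrix.of_apply, Matrix.map_apply, Matrix.mul_apply, map_sum,
    Matrix.one_apply, smul_ite, smul_zero, Finset.sum_ite_eq', Finset.mem_univ, if_true, smul_smul,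
    Algebra.algebraMap_eq_smul_one, mul_comm]

theorem map_mulRight_mulLeft {M' F : Type*} [AddCommGroup M'] [Module ℂ M'] [FunLike F M M']
    [LinearMapClass F ℂ M M'] (f : F) (α : Matrix (Fin a) (Fin b) ℂ)
    (P : Matrix (Fin b) (Fin c) M) (β : Matrix (Fin c) (Fin d) ℂ) :
    (mulRight (mulLeft α P) β).map f = mulRight (mulLeft α (P.map f)) β := by
  ext i j
  simp [mulRight, mulLeft]

end MatrixActions

/-! ### Norms of columns and forms of operator matrices. -/

section SqNorm

variable {Y : Type*} [NormedAddCommGroup Y] {n : ℕ}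

/-- The square of the Hilbert space norm of a column of vectors. -/
noncomputable def sqNorm (x : Fin n → Y) : ℝ := ∑ p, ‖x p‖ ^ 2

theorem sqNorm_nonneg (x : Fin n → Y) : 0 ≤ sqNorm x := by
  unfold sqNorm; positivity

@[simp] theorem sqNorm_zero : sqNorm (0 : Fin n → Y) = 0 := by simp [sqNorm]

theorem sqNorm_single (p : Fin n) (e : Y) : sqNorm (Pi.single p e : Fin n → Y) = ‖e‖ ^ 2 := by
  rw [sqNorm, Finset.sum_eq_single p]
  · simp
  · intro b _ hb
    simp [Pi.single_eq_of_ne hb]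
  · simp

end SqNorm

section BlockForm

variable {Y : Type*} [NormedAddCommGroup Y] [InnerProductSpace ℂ Y] {n m : ℕ}

/-- The block form as a linear functional of the operator matrix. -/
noncomputable def blockFormLin (x : Fin n → Y) (y : Fin m → Y) :
    Matrix (Fin n) (Fin m) (Y →L[ℂ] Y) →ₗ[ℂ] ℂ where
  toFun T := blockForm T x y
  map_add' T T' := by simp [blockForm, Finset.sum_add_distrib]
  map_smul' r T := by simp [blockForm, Finset.mul_sum]

@[simp] theorem blockFormLin_apply (x : Fin n → Y) (y : Fin m → Y)
    (T : Matrix (Fin n) (Fin m) (Y →L[ℂ] Y)) : blockFormLin x y T = blockForm T x y := rfl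

theorem blockForm_add (T T' : Matrix (Fin n) (Fin m) (Y →L[ℂ] Y)) (x : Fin n → Y)
    (y : Fin m → Y) : blockForm (T + T') x y = blockForm T x y + blockForm T' x y :=
  map_add (blockFormLin x y) T T'

theorem blockForm_smul (r : ℂ) (T : Matrix (Fin n) (Fin m) (Y →L[ℂ] Y)) (x : Fin n → Y)
    (y : Fin m → Y) : blockForm (r • T) x y = r * blockForm T x y :=
  map_smul (blockFormLin x y) r T

theorem blockForm_sum {ι : Type*} (s : Finset ι) (T : ι → Matrix (Fin n) (Fin m) (Y →L[ℂ] Y))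
    (x : Fin n → Y) (y : Fin m → Y) :
    blockForm (∑ i ∈ s, T i) x y = ∑ i ∈ s, blockForm (T i) x y :=
  map_sum (blockFormLin x y) T s

theorem blockForm_sum_left {ι : Type*} (s : Finset ι) (T : Matrix (Fin n) (Fin m) (Y →L[ℂ] Y))
    (x : ι → Fin n → Y) (y : Fin m → Y) :
    blockForm T (∑ i ∈ s, x i) y = ∑ i ∈ s, blockForm T (x i) y := by
  simp only [blockForm, Finset.sum_apply, sum_inner]
  rw [Finset.sum_comm]
  conv_rhs => rw [Finset.sum_comm]; enter [2, p]; rw [Finset.sum_comm]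
  exact Finset.sum_comm

theorem blockForm_sum_right {ι : Type*} (s : Finset ι) (T : Matrix (Fin n) (Fin m) (Y →L[ℂ] Y))
    (x : Fin n → Y) (y : ι → Fin m → Y) :
    blockForm T x (∑ i ∈ s, y i) = ∑ i ∈ s, blockForm T x (y i) := by
  simp only [blockForm, Finset.sum_apply, map_sum, inner_sum]
  conv_rhs => rw [Finset.sum_comm]; enter [2, p]; rw [Finset.sum_comm]

theorem blockForm_mulLeft {a b c : ℕ} (α : Matrix (Fin a) (Fin b) ℂ)
    (T : Matrix (Fin b) (Fin c) (Y →L[ℂ] Y)) (x : Fin a → Y) (y : Fin c → Y) :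
    blockForm (mulLeft α T) x y = blockForm T (act α.conjTranspose x) y := by
  simp only [blockForm, mulLeft, act, Matrix.of_apply, Matrix.conjTranspose_apply, sum_apply,
    smul_apply, inner_sum, sum_inner, inner_smul_left, inner_smul_right, RCLike.star_def,
    RingHomCompTriple.comp_apply, RingHom.id_apply]
  rw [Finset.sum_comm]
  conv_rhs => rw [Finset.sum_comm]
  exact Finset.sum_congr rfl fun q _ => Finset.sum_comm

theorem blockForm_mulRight {a b c : ℕ} (T : Matrix (Fin a) (Fin b) (Y →L[ℂ] Y))
    (β : Matrix (Fin b) (Fin c) ℂ) (x : Fin a → Y) (y : Fin c → Y) :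
    blockForm (mulRight T β) x y = blockForm T x (act β y) := by
  simp only [blockForm, mulRight, act, Matrix.of_apply, sum_apply, smul_apply, map_sum, map_smul,
    inner_sum, inner_smul_right]
  exact Finset.sum_congr rfl fun p _ => Finset.sum_comm

theorem blockForm_mulRight_mulLeft {a b c d : ℕ} (α : Matrix (Fin a) (Fin b) ℂ)
    (T : Matrix (Fin b) (Fin c) (Y →L[ℂ] Y)) (β : Matrix (Fin c) (Fin d) ℂ)
    (x : Fin a → Y) (y : Fin d → Y) :
    blockForm (mulRight (mulLeft α T) β) x y = blockForm T (act α.conjTranspose x) (act β y) := by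
  rw [blockForm_mulRight, blockForm_mulLeft]

theorem blockForm_single [DecidableEq (Fin n)] [DecidableEq (Fin m)]
    (T : Matrix (Fin n) (Fin m) (Y →L[ℂ] Y)) (p : Fin n)
    (q : Fin m) (e f : Y) :
    blockForm T (Pi.single p e) (Pi.single q f) = inner ℂ e (T p q f) := by
  rw [blockForm, Finset.sum_eq_single p, Finset.sum_eq_single q]
  · simp
  · intro b _ hb
    simp [Pi.single_eq_of_ne hb]
  · simp
  · intro b _ hb
    simp [Pi.single_eq_of_ne hb]
  · simp

theorem blockForm_ext {T T' : Matrix (Fin n) (Fin m) (Y →L[ℂ] Y)}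
    (h : ∀ x y, blockForm T x y = blockForm T' x y) : T = T' := by
  ext p q f
  refine ext_inner_left ℂ fun e => ?_
  rw [← blockForm_single T, ← blockForm_single T', h]

theorem blockForm_conjTranspose [CompleteSpace Y] (T : Matrix (Fin n) (Fin m) (Y →L[ℂ] Y))
    (x : Fin m → Y) (y : Fin n → Y) :
    blockForm T.conjTranspose x y = star (blockForm T y x) := by
  simp only [blockForm, Matrix.conjTranspose_apply, ContinuousLinearMap.star_eq_adjoint,
    ContinuousLinearMap.adjoint_inner_right, star_sum, RCLike.star_def, inner_conj_symm]
  exact Finset.sum_comm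

theorem blockForm_one (x : Fin n → Y) :
    blockForm (1 : Matrix (Fin n) (Fin n) (Y →L[ℂ] Y)) x x = (sqNorm x : ℂ) := by
  rw [blockForm, sqNorm]
  push_cast
  refine Finset.sum_congr rfl fun p _ => ?_
  rw [Finset.sum_eq_single p]
  · simp [inner_self_eq_norm_sq_to_K]
  · intro b _ hb
    simp [Matrix.one_apply_ne hb.symm]
  · simp

theorem exists_norm_blockForm_le (T : Matrix (Fin n) (Fin m) (Y →L[ℂ] Y)) :
    ∃ t : ℝ, 0 ≤ t ∧ ∀ x y, ‖blockForm T x y‖ ≤ t * (sqNorm x + sqNorm y) := by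
  refine ⟨∑ p, ∑ q, ‖T p q‖, by positivity, fun x y => ?_⟩
  refine (norm_sum_le _ _).trans ?_
  rw [Finset.sum_mul]
  refine Finset.sum_le_sum fun p _ => (norm_sum_le _ _).trans ?_
  rw [Finset.sum_mul]
  refine Finset.sum_le_sum fun q _ => ?_
  have h1 : ‖x p‖ ^ 2 ≤ sqNorm x :=
    Finset.single_le_sum (f := fun p => ‖x p‖ ^ 2) (fun _ _ => by positivity) (Finset.mem_univ p)
  have h2 : ‖y q‖ ^ 2 ≤ sqNorm y :=
    Finset.single_le_sum (f := fun p => ‖y p‖ ^ 2) (fun _ _ => by positivity) (Finset.mem_univ q)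
  calc ‖inner ℂ (x p) (T p q (y q))‖ ≤ ‖x p‖ * (‖T p q‖ * ‖y q‖) :=
        (norm_inner_le_norm _ _).trans (by gcongr; exact (T p q).le_opNorm _)
    _ = ‖T p q‖ * (‖x p‖ * ‖y q‖) := by ring
    _ ≤ ‖T p q‖ * (sqNorm x + sqNorm y) := by
        gcongr
        nlinarith [sq_nonneg (‖x p‖ - ‖y q‖), norm_nonneg (x p), norm_nonneg (y q)]

/-- Cauchy–Schwarz with the Hilbert–Schmidt norm of `α`; 1 is added to the constant so that one may
divide by it even when `α = 0`. -/
theorem exists_sqNorm_act_le (α : Matrix (Fin n) (Fin m) ℂ) :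
    ∃ C : ℝ, 0 < C ∧ ∀ x : Fin m → Y, sqNorm (act α x) ≤ C * sqNorm x := by
  refine ⟨∑ p, ∑ k, ‖α p k‖ ^ 2 + 1, by positivity, fun x => ?_⟩
  have h : sqNorm (act α x) ≤ (∑ p, ∑ k, ‖α p k‖ ^ 2) * sqNorm x := by
    rw [Finset.sum_mul]
    refine Finset.sum_le_sum fun p _ => ?_
    calc ‖∑ k, α p k • x k‖ ^ 2 ≤ (∑ k, ‖α p k‖ * ‖x k‖) ^ 2 := by
          gcongr
          exact (norm_sum_le _ _).trans (by simp [norm_smul])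
      _ ≤ _ := Finset.sum_mul_sq_le_sq_mul_sq _ _ _
  linarith [sqNorm_nonneg x]

end BlockForm

/-! ### Intertwinings and the scalar form of the kernel property. -/

section Kernels

variable {V : Type*} [AddCommGroup V] [Module ℂ V]
variable {A : Type*} [CStarAlgebra A]
variable {Y : Type*} [NormedAddCommGroup Y] [InnerProductSpace ℂ Y] [CompleteSpace Y]

theorem IsNcKernelOn.blockForm_eq {Ω : Set (NcPoint V)} {K : GradedKernel V A (Y →L[ℂ] Y)}
    (hK : IsNcKernelOn Ω K) {Z Z' W W' : NcPoint V} (hZ : Z ∈ Ω) (hZ' : Z' ∈ Ω) (hW : W ∈ Ω)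
    (hW' : W' ∈ Ω) {α : Matrix (Fin Z'.size) (Fin Z.size) ℂ}
    {β : Matrix (Fin W'.size) (Fin W.size) ℂ} (hα : Intertwines Z Z' α)
    (hβ : Intertwines W W' β) (P : Matrix (Fin Z.size) (Fin W.size) A) (x : Fin Z'.size → Y)
    (y : Fin W'.size → Y) :
    blockForm (K Z' W' (mulRight (mulLeft α P) β.conjTranspose)) x y =
      blockForm (K Z W P) (act α.conjTranspose x) (act β.conjTranspose y) := by
  rw [← hK Z hZ Z' hZ' W hW W' hW' α β hα hβ P, blockForm_mulRight_mulLeft]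

theorem intertwines_smul_one (Z : NcPoint V) (r : ℂ) :
    Intertwines Z Z (r • (1 : Matrix (Fin Z.size) (Fin Z.size) ℂ)) := by
  rw [Intertwines, mulLeft_smul_one, mulRight_smul_one]

theorem intertwines_one (Z : NcPoint V) : Intertwines Z Z 1 := by
  rw [Intertwines, mulLeft_one, mulRight_one]

theorem Intertwines.mul {Z Z' Z'' : NcPoint V} {α : Matrix (Fin Z'.size) (Fin Z.size) ℂ}
    {β : Matrix (Fin Z''.size) (Fin Z'.size) ℂ} (hβ : Intertwines Z' Z'' β)
    (hα : Intertwines Z Z' α) : Intertwines Z Z'' (β * α) := by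
  rw [Intertwines] at *
  rw [← mulLeft_mulLeft, hα, ← mulRight_mulLeft, hβ, mulRight_mulRight]

end Kernels

/-! ### Orthogonal direct sums, the full envelope and similarity. -/

section DirectSums

variable {V : Type*} [AddCommGroup V] [Module ℂ V]

/-- The inclusion of the first summand into a direct sum. -/
def inclLeft (n m : ℕ) : Matrix (Fin (n + m)) (Fin n) ℂ :=
  (Matrix.fromRows 1 0).submatrix finSumFinEquiv.symm id

/-- The inclusion of the second summand into a direct sum. -/
def inclRight (n m : ℕ) : Matrix (Fin (n + m)) (Fin m) ℂ :=
  (Matrix.fromRows 0 1).submatrix finSumFinEquiv.symm id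

variable (n m : ℕ)

@[simp] theorem inclLeft_castAdd (i : Fin n) (j : Fin n) :
    inclLeft n m (Fin.castAdd m i) j = (1 : Matrix (Fin n) (Fin n) ℂ) i j := by
  simp [inclLeft]

@[simp] theorem inclLeft_natAdd (i : Fin m) (j : Fin n) :
    inclLeft n m (Fin.natAdd n i) j = 0 := by
  simp [inclLeft]

@[simp] theorem inclRight_castAdd (i : Fin n) (j : Fin m) :
    inclRight n m (Fin.castAdd m i) j = 0 := by
  simp [inclRight]

@[simp] theorem inclRight_natAdd (i : Fin m) (j : Fin m) :
    inclRight n m (Fin.natAdd n i) j = (1 : Matrix (Fin m) (Fin m) ℂ) i j := by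
  simp [inclRight]

theorem inclLeft_conjTranspose_mul : (inclLeft n m).conjTranspose * inclLeft n m = 1 := by
  ext i j
  simp [Matrix.mul_apply, Fin.sum_univ_add, Matrix.one_apply, apply_ite, eq_comm]

theorem inclRight_conjTranspose_mul : (inclRight n m).conjTranspose * inclRight n m = 1 := by
  ext i j
  simp [Matrix.mul_apply, Fin.sum_univ_add, Matrix.one_apply, apply_ite, eq_comm]

theorem inclLeft_conjTranspose_mul_inclRight :
    (inclLeft n m).conjTranspose * inclRight n m = 0 := by
  ext i j
  simp [Matrix.mul_apply, Fin.sum_univ_add]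

theorem inclLeft_mul_add_inclRight_mul :
    inclLeft n m * (inclLeft n m).conjTranspose + inclRight n m * (inclRight n m).conjTranspose
      = 1 := by
  ext i j
  refine Fin.addCases (fun i => ?_) (fun i => ?_) i <;>
    refine Fin.addCases (fun j => ?_) (fun j => ?_) j <;>
    simp only [Matrix.add_apply, Matrix.mul_apply, Matrix.conjTranspose_apply, inclLeft_castAdd,
      inclLeft_natAdd, inclRight_castAdd, inclRight_natAdd, star_zero, mul_zero,
      Finset.sum_const_zero, add_zero, zero_add, Matrix.one_apply, apply_ite star, star_one,
      mul_ite, mul_one, ite_self, Finset.sum_ite_eq, Finset.mem_univ, if_true] <;>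
    simp only [Fin.ext_iff, Fin.val_castAdd, Fin.val_natAdd, add_right_inj] <;>
    rw [if_neg (by omega)]

theorem intertwines_inclLeft (Z W : NcPoint V) :
    Intertwines Z (Z.directSum W) (inclLeft Z.size W.size) := by
  ext i j
  change Fin (Z.size + W.size) at i
  change ∑ k, inclLeft Z.size W.size i k • Z.mat k j = ∑ k : Fin (Z.size + W.size),
    inclLeft Z.size W.size k j • (Z.directSum W).mat i k
  rw [Fin.sum_univ_add]
  refine Fin.addCases (fun i => ?_) (fun i => ?_) i <;>
    simp [NcPoint.directSum, Matrix.one_apply, ite_smul]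

theorem intertwines_inclRight (Z W : NcPoint V) :
    Intertwines W (Z.directSum W) (inclRight Z.size W.size) := by
  ext i j
  change Fin (Z.size + W.size) at i
  change ∑ k, inclRight Z.size W.size i k • W.mat k j = ∑ k : Fin (Z.size + W.size),
    inclRight Z.size W.size k j • (Z.directSum W).mat i k
  rw [Fin.sum_univ_add]
  refine Fin.addCases (fun i => ?_) (fun i => ?_) i <;>
    simp [NcPoint.directSum, Matrix.one_apply, ite_smul]

theorem intertwines_inclLeft_conjTranspose (Z W : NcPoint V) :
    Intertwines (Z.directSum W) Z (inclLeft Z.size W.size).conjTranspose := by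
  ext i j
  change Fin (Z.size + W.size) at j
  change ∑ k : Fin (Z.size + W.size), star (inclLeft Z.size W.size k i) • (Z.directSum W).mat k j
    = ∑ k, star (inclLeft Z.size W.size j k) • Z.mat i k
  rw [Fin.sum_univ_add]
  refine Fin.addCases (fun i => ?_) (fun i => ?_) j <;>
    simp [NcPoint.directSum, Matrix.one_apply, ite_smul, apply_ite]

theorem intertwines_inclRight_conjTranspose (Z W : NcPoint V) :
    Intertwines (Z.directSum W) W (inclRight Z.size W.size).conjTranspose := by
  ext i j
  change Fin (Z.size + W.size) at j
  change ∑ k : Fin (Z.size + W.size), star (inclRight Z.size W.size k i) • (Z.directSum W).mat k j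
    = ∑ k, star (inclRight Z.size W.size j k) • W.mat i k
  rw [Fin.sum_univ_add]
  refine Fin.addCases (fun i => ?_) (fun i => ?_) j <;>
    simp [NcPoint.directSum, Matrix.one_apply, ite_smul, apply_ite]

/-- Only the relations between the two inclusions are kept, so that the block structure of the sum
need not be opened again. -/
theorem IsFullNcSet.exists_directSum {Ξ : Set (NcPoint V)} (hΞ : IsFullNcSet Ξ)
    {Z W : NcPoint V} (hZ : Z ∈ Ξ) (hW : W ∈ Ξ) :
    ∃ Z₀ ∈ Ξ, ∃ (L : Matrix (Fin Z₀.size) (Fin Z.size) ℂ)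
      (R : Matrix (Fin Z₀.size) (Fin W.size) ℂ),
      Intertwines Z Z₀ L ∧ Intertwines W Z₀ R ∧ Intertwines Z₀ Z L.conjTranspose ∧
      Intertwines Z₀ W R.conjTranspose ∧ L.conjTranspose * L = 1 ∧ R.conjTranspose * R = 1 ∧
      L.conjTranspose * R = 0 ∧ L * L.conjTranspose + R * R.conjTranspose = 1 :=
  ⟨Z.directSum W, hΞ.directSum_mem _ hZ _ hW, inclLeft _ _, inclRight _ _,
    intertwines_inclLeft _ _, intertwines_inclRight _ _, intertwines_inclLeft_conjTranspose _ _,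
    intertwines_inclRight_conjTranspose _ _, inclLeft_conjTranspose_mul _ _,
    inclRight_conjTranspose_mul _ _, inclLeft_conjTranspose_mul_inclRight _ _,
    inclLeft_mul_add_inclRight_mul _ _⟩

/-- `Z₀` is an orthogonal direct sum of the points `Z k`, `k ∈ s`, with the coisometries
`(J k)ᴴ` as projections. -/
structure IsOrthogonalSum {κ : Type*} (s : Finset κ) (Z : κ → NcPoint V) (Z₀ : NcPoint V)
    (J : ∀ k, Matrix (Fin Z₀.size) (Fin (Z k).size) ℂ) : Prop where
  intertwines : ∀ k ∈ s, Intertwines (Z k) Z₀ (J k)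
  intertwines_conjTranspose : ∀ k ∈ s, Intertwines Z₀ (Z k) (J k).conjTranspose
  isometry : ∀ k ∈ s, (J k).conjTranspose * J k = 1
  orthogonal : ∀ k ∈ s, ∀ l ∈ s, k ≠ l → (J k).conjTranspose * J l = 0
  sum_eq_one : ∑ k ∈ s, J k * (J k).conjTranspose = 1

/-- Points have positive size, so no empty sum exists and the induction starts from a single
summand. Adding a point composes the old inclusions with the isometry `R`. -/
theorem IsFullNcSet.exists_isOrthogonalSum {Ξ : Set (NcPoint V)} (hΞ : IsFullNcSet Ξ)
    {κ : Type*} (Z : κ → NcPoint V) {s : Finset κ} (hs : s.Nonempty) (hZ : ∀ k ∈ s, Z k ∈ Ξ) :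
    ∃ Z₀ ∈ Ξ, ∃ J : ∀ k, Matrix (Fin Z₀.size) (Fin (Z k).size) ℂ, IsOrthogonalSum s Z Z₀ J := by
  classical
  induction hs using Finset.Nonempty.cons_induction with
  | singleton a =>
    refine ⟨Z a, hZ a (by simp), Function.update (fun _ => 0) a 1, ?_⟩
    constructor <;> simp [intertwines_one]
  | cons a s ha hs ih =>
    obtain ⟨Z₀, hZ₀, J, hJ⟩ := ih fun k hk => hZ k (Finset.mem_cons_of_mem hk)
    have hne : ∀ k ∈ s, k ≠ a := fun k hk h => ha (h ▸ hk)
    obtain ⟨Z₁, hZ₁, L, R, hL, hR, hL', hR', hLL, hRR, hLR, hone⟩ :=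
      hΞ.exists_directSum (hZ a (by simp)) hZ₀
    have hRL : R.conjTranspose * L = 0 := by
      rw [← Matrix.conjTranspose_conjTranspose L, ← Matrix.conjTranspose_mul, hLR,
        Matrix.conjTranspose_zero]
    refine ⟨Z₁, hZ₁, Function.update (fun k => R * J k) a L, ?_⟩
    constructor
    · intro k hk
      rcases Finset.mem_cons.1 hk with rfl | hk
      · rwa [Function.update_self]
      · rw [Function.update_of_ne (hne k hk)]
        exact hR.mul (hJ.intertwines k hk)
    · intro k hk
      rcases Finset.mem_cons.1 hk with rfl | hk
      · rwa [Function.update_self]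
      · rw [Function.update_of_ne (hne k hk), Matrix.conjTranspose_mul]
        exact (hJ.intertwines_conjTranspose k hk).mul hR'
    · intro k hk
      rcases Finset.mem_cons.1 hk with rfl | hk
      · rwa [Function.update_self]
      · rw [Function.update_of_ne (hne k hk), Matrix.conjTranspose_mul, Matrix.mul_assoc,
          ← Matrix.mul_assoc _ R, hRR, Matrix.one_mul, hJ.isometry k hk]
    · intro k hk l hl hkl
      rcases Finset.mem_cons.1 hk with rfl | hk' <;> rcases Finset.mem_cons.1 hl with rfl | hl'
      · exact absurd rfl hkl
      · rw [Function.update_self, Function.update_of_ne (hne l hl'), ← Matrix.mul_assoc,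
          hLR, Matrix.zero_mul]
      · rw [Function.update_self, Function.update_of_ne (hne k hk'), Matrix.conjTranspose_mul,
          Matrix.mul_assoc, hRL, Matrix.mul_zero]
      · rw [Function.update_of_ne (hne k hk'), Function.update_of_ne (hne l hl'),
          Matrix.conjTranspose_mul, Matrix.mul_assoc, ← Matrix.mul_assoc _ R,
          hRR, Matrix.one_mul, hJ.orthogonal k hk' l hl' hkl]
    · rw [Finset.sum_cons, Function.update_self, ← hone]
      congr 1
      calc _ = ∑ k ∈ s, R * (J k * (J k).conjTranspose) * R.conjTranspose :=
            Finset.sum_congr rfl fun k hk => by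
              rw [Function.update_of_ne (hne k hk), Matrix.conjTranspose_mul]
              simp only [Matrix.mul_assoc]
          _ = _ := by
            rw [← Matrix.sum_mul, ← Matrix.mul_sum, hJ.sum_eq_one, Matrix.mul_one]

theorem isFullNcSet_fullEnvelope (Ω : Set (NcPoint V)) : IsFullNcSet (fullEnvelope Ω) where
  directSum_mem _ hZ _ hW Ξ hΞ := hΞ.1.directSum_mem _ (hZ Ξ hΞ) _ (hW Ξ hΞ)
  mem_of_injective _ hZ Z' J hJ h Ξ hΞ := hΞ.1.mem_of_injective _ (hZ Ξ hΞ) Z' J hJ h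

theorem subset_fullEnvelope (Ω : Set (NcPoint V)) : Ω ⊆ fullEnvelope Ω :=
  fun _ hZ _ hΞ => hΞ.2 hZ

theorem fullEnvelope_subset {Ω Ξ : Set (NcPoint V)} (hΞ : IsFullNcSet Ξ) (h : Ω ⊆ Ξ) :
    fullEnvelope Ω ⊆ Ξ :=
  fun _ hZ => hZ Ξ ⟨hΞ, h⟩

/-- The point similar to `Z` under an invertible matrix `J`. -/
theorem exists_similar (Z : NcPoint V) {J : Matrix (Fin Z.size) (Fin Z.size) ℂ}
    (hJ : IsUnit J.det) :
    ∃ (Z' : NcPoint V) (L : Matrix (Fin Z.size) (Fin Z'.size) ℂ)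
      (L' : Matrix (Fin Z'.size) (Fin Z.size) ℂ), Intertwines Z' Z L ∧ L' * L = 1 ∧
      L * L.conjTranspose = J * J.conjTranspose ∧ ∀ Ξ, IsFullNcSet Ξ → Z ∈ Ξ → Z' ∈ Ξ := by
  have hZ' : Intertwines ⟨Z.size, Z.size_pos, mulRight (mulLeft J⁻¹ Z.mat) J⟩ Z J := by
    rw [Intertwines, mulRight_mulLeft, mulLeft_mulLeft, Matrix.mul_nonsing_inv _ hJ]
    exact mulLeft_one _
  exact ⟨⟨Z.size, Z.size_pos, mulRight (mulLeft J⁻¹ Z.mat) J⟩, J, J⁻¹, hZ',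
    Matrix.nonsing_inv_mul _ hJ, rfl, fun Ξ hΞ hZ => hΞ.mem_of_injective Z hZ _ J
      (Matrix.mulVec_injective_iff_isUnit.2 ((Matrix.isUnit_iff_isUnit_det J).2 hJ)) hZ'⟩

end DirectSums

/-! ### Positivity of the kernel S on the cone cut out by Q. -/

section Positivity

section

variable {M : Type*} [AddCommGroup M] [Module ℂ M] {a b : ℕ}

theorem act_sum {ι : Type*} (s : Finset ι) (α : Matrix (Fin a) (Fin b) ℂ) (x : ι → Fin b → M) :
    act α (∑ i ∈ s, x i) = ∑ i ∈ s, act α (x i) := by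
  funext p
  simp only [act, Finset.sum_apply, Finset.smul_sum]
  exact Finset.sum_comm

@[simp] theorem act_zero (x : Fin b → M) : act (0 : Matrix (Fin a) (Fin b) ℂ) x = 0 := by
  funext p
  simp [act]

variable {Y : Type*} [NormedAddCommGroup Y] [InnerProductSpace ℂ Y]

/-- The block form of the operator matrix obtained by applying `π` to every entry. -/
noncomputable def mapBlockForm {n m : ℕ} (π : M →ₗ[ℂ] (Y →L[ℂ] Y)) (x : Fin n → Y)
    (y : Fin m → Y) : Matrix (Fin n) (Fin m) M →ₗ[ℂ] ℂ :=
  blockFormLin x y ∘ₗ π.mapMatrix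

theorem mapBlockForm_apply {n m : ℕ} (π : M →ₗ[ℂ] (Y →L[ℂ] Y)) (x : Fin n → Y)
    (y : Fin m → Y) (P : Matrix (Fin n) (Fin m) M) :
    mapBlockForm π x y P = blockForm (P.map π) x y := rfl

theorem mapBlockForm_mulRight_mulLeft {c d : ℕ} (π : M →ₗ[ℂ] (Y →L[ℂ] Y))
    (α : Matrix (Fin a) (Fin b) ℂ) (P : Matrix (Fin b) (Fin c) M) (β : Matrix (Fin c) (Fin d) ℂ)
    (x : Fin a → Y) (y : Fin d → Y) :
    mapBlockForm π x y (mulRight (mulLeft α P) β) =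
      mapBlockForm π (act α.conjTranspose x) (act β y) P := by
  rw [mapBlockForm_apply, map_mulRight_mulLeft, blockForm_mulRight_mulLeft]
  rfl

end

variable {V : Type*} [AddCommGroup V] [Module ℂ V]
  {N : Type*} [NormedAddCommGroup N] [InnerProductSpace ℂ N] [CompleteSpace N]
  {E : Type*} [NormedAddCommGroup E] [InnerProductSpace ℂ E] [CompleteSpace E]

open scoped MatrixOrder in
theorem exists_mul_conjTranspose_of_posDef {n : ℕ} {H : Matrix (Fin n) (Fin n) ℂ}
    (hH : H.PosDef) : ∃ J : Matrix (Fin n) (Fin n) ℂ, IsUnit J.det ∧ J * J.conjTranspose = H := by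
  obtain ⟨B, hB⟩ : ∃ B : Matrix (Fin n) (Fin n) ℂ, H = B.conjTranspose * B := by
    refine ⟨CFC.sqrt H, ?_⟩
    rw [← Matrix.star_eq_conjTranspose, (CFC.sqrt_nonneg H).isSelfAdjoint.star_eq,
      CFC.sqrt_mul_sqrt_self H hH.posSemidef.nonneg]
  refine ⟨B.conjTranspose, ?_, by rw [Matrix.conjTranspose_conjTranspose, hB]⟩
  have h := hH.det_pos.ne'
  rw [hB, Matrix.det_mul] at h
  exact isUnit_iff_ne_zero.2 (left_ne_zero_of_mul h)

/-- Hermitian symmetry makes the form of `Q(Z, Z)(1)` real, so its real part decides. -/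
theorem blockStrictlyPos_of_re {Ξ : Set (NcPoint V)} {Q : GradedKernel V ℂ (N →L[ℂ] N)}
    (hQ : IsHermitianOn Ξ Q) {Z : NcPoint V} (hZ : Z ∈ Ξ) {ε : ℝ} (hε : 0 < ε)
    (h : ∀ y, ε * sqNorm y ≤ (blockForm (Q Z Z 1) y y).re) : BlockStrictlyPos (Q Z Z 1) := by
  refine ⟨ε, hε, fun y => ?_⟩
  have hs := blockForm_conjTranspose (Q Z Z 1) y y
  rw [hQ Z hZ Z hZ, Matrix.conjTranspose_one] at hs
  rw [Complex.le_def]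
  refine ⟨h y, ?_⟩
  have := congrArg Complex.im hs
  simp only [RCLike.star_def, Complex.conj_im] at this
  rw [Complex.ofReal_im]
  linarith

theorem BlockStrictlyPos.exists_re {n : ℕ} {T : Matrix (Fin n) (Fin n) (N →L[ℂ] N)}
    (hT : BlockStrictlyPos T) :
    ∃ ε : ℝ, 0 < ε ∧ ∀ y, ε * sqNorm y ≤ (blockForm T y y).re := by
  obtain ⟨ε, hε, h⟩ := hT
  exact ⟨ε, hε, fun y => (Complex.le_def.1 (h y)).1⟩

/-- Write `H = J J*` and pass to `Z' = J⁻¹ Z J`. Since `J` intertwines `Z'` with `Z`, both kernels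
satisfy `K(Z, Z)(H) = J K(Z', Z')(1) J*`. Strict positivity of `Q` at `H` thus puts `Z'` in the
domain, and positivity of `S` at `Z'` comes back to `Z`. -/
theorem re_blockForm_nonneg_of_posDef {Ξ Ξ' : Set (NcPoint V)} (hΞ : IsFullNcSet Ξ)
    (hΞ' : IsFullNcSet Ξ') {Q : GradedKernel V ℂ (N →L[ℂ] N)} (hQ : IsNcKernelOn Ξ Q)
    (hQherm : IsHermitianOn Ξ Q) {S : GradedKernel V ℂ (E →L[ℂ] E)}
    (hS : IsNcKernelOn (Ξ' ∩ strictPosDomain Ξ Q) S)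
    (hSpos : ∀ Z ∈ Ξ' ∩ strictPosDomain Ξ Q, BlockNonneg (S Z Z 1))
    {Z : NcPoint V} (hZ : Z ∈ Ξ' ∩ strictPosDomain Ξ Q) {H : Matrix (Fin Z.size) (Fin Z.size) ℂ}
    (hH : H.PosDef) {ε : ℝ} (hε : 0 < ε)
    (hQH : ∀ ν, ε * sqNorm ν ≤ (blockForm (Q Z Z H) ν ν).re) (y : Fin Z.size → E) :
    0 ≤ (blockForm (S Z Z H) y y).re := by
  obtain ⟨J, hJ, rfl⟩ := exists_mul_conjTranspose_of_posDef hH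
  obtain ⟨Z', L, L', hL, hL', hLL, hfull⟩ := exists_similar Z hJ
  rw [← hLL] at hQH ⊢
  have hmul : mulRight (mulLeft L 1) L.conjTranspose = L * L.conjTranspose := by
    rw [mulRight_mulLeft_eq_mul, Matrix.mul_one]
  have hZ' : Z' ∈ Ξ := hfull Ξ hΞ hZ.2.1
  have hmem : Z' ∈ Ξ' ∩ strictPosDomain Ξ Q := by
    refine ⟨hfull Ξ' hΞ' hZ.1, hZ', ?_⟩
    -- Since `ν = L* (L'* ν)`, the column `L'* ν` has square norm at least `sqNorm ν / C`; hence the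
    -- lower bound `ε / C` at `Z'`.
    obtain ⟨C, hC, hCle⟩ := exists_sqNorm_act_le (Y := N) L.conjTranspose
    refine blockStrictlyPos_of_re hQherm hZ' (div_pos hε hC) fun ν => ?_
    have hν : act L.conjTranspose (act L'.conjTranspose ν) = ν := by
      rw [← act_mul, ← Matrix.conjTranspose_mul, hL', Matrix.conjTranspose_one, act_one]
    have key := hQ.blockForm_eq hZ' hZ.2.1 hZ' hZ.2.1 hL hL 1
      (act L'.conjTranspose ν) (act L'.conjTranspose ν)
    have hle := hCle (act L'.conjTranspose ν)
    rw [hν] at hle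
    rw [hmul, hν] at key
    rw [← key]
    refine le_trans ?_ (hQH _)
    rw [div_mul_eq_mul_div, div_le_iff₀ hC]
    nlinarith
  have key := hS.blockForm_eq hmem hZ hmem hZ hL hL 1 y y
  rw [hmul] at key
  rw [key]
  exact (Complex.le_def.1 (hSpos _ hmem _)).1

theorem IsHermitianOn.re_blockForm_eq {Ξ : Set (NcPoint V)} {K : GradedKernel V ℂ (E →L[ℂ] E)}
    (hK : IsHermitianOn Ξ K) {Z : NcPoint V} (hZ : Z ∈ Ξ)
    (G : Matrix (Fin Z.size) (Fin Z.size) ℂ) (δ : ℝ) (v : Fin Z.size → E) :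
    (blockForm (K Z Z (G + G.conjTranspose + ((2 * δ : ℝ) : ℂ) • 1)) v v).re =
      2 * ((blockForm (K Z Z G) v v).re + δ * (blockForm (K Z Z 1) v v).re) := by
  rw [map_add, map_add, map_smul, ← hK Z hZ Z hZ, blockForm_add, blockForm_add,
    blockForm_conjTranspose, blockForm_smul, Complex.add_re, Complex.add_re,
    Complex.re_ofReal_mul, RCLike.star_def, Complex.conj_re]
  ring

/-- Accretivity of `G` only makes `G + G*` semidefinite; the multiple of the identity makes it
definite, as a factorization with invertible factor requires. -/
theorem posDef_add_conjTranspose_add {n : ℕ} {G : Matrix (Fin n) (Fin n) ℂ}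
    (hG : ∀ w : Fin n → ℂ, 0 ≤ (blockForm (G.map (algebraMap ℂ (ℂ →L[ℂ] ℂ))) w w).re) {δ : ℝ}
    (hδ : 0 < δ) : (G + G.conjTranspose + ((2 * δ : ℝ) : ℂ) • 1).PosDef := by
  refine Matrix.PosDef.of_dotProduct_mulVec_pos ?_ fun w hw => ?_
  · rw [Matrix.IsHermitian, Matrix.conjTranspose_add, Matrix.conjTranspose_add,
      Matrix.conjTranspose_conjTranspose, Matrix.conjTranspose_smul, Matrix.conjTranspose_one,
      RCLike.star_def, Complex.conj_ofReal, add_comm G]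
  · have h1 : blockForm (G.map (algebraMap ℂ (ℂ →L[ℂ] ℂ))) w w = star w ⬝ᵥ G.mulVec w := by
      simp only [blockForm, dotProduct, Matrix.mulVec, Finset.mul_sum]
      refine Finset.sum_congr rfl fun p _ => Finset.sum_congr rfl fun q _ => ?_
      simp [Algebra.algebraMap_eq_smul_one, mul_comm]
    have h2 : star w ⬝ᵥ G.conjTranspose.mulVec w = star (star w ⬝ᵥ G.mulVec w) := by
      rw [Matrix.mulVec_conjTranspose, Matrix.star_dotProduct_star, Matrix.dotProduct_mulVec]
    have hw' : (0 : ℂ) < star w ⬝ᵥ w := by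
      simpa using hw
    have h3 : (0 : ℂ) ≤ star w ⬝ᵥ G.mulVec w + star (star w ⬝ᵥ G.mulVec w) := by
      rw [RCLike.star_def, Complex.add_conj]
      have := hG w
      rw [h1] at this
      exact_mod_cast mul_nonneg zero_le_two this
    rw [Matrix.add_mulVec, Matrix.add_mulVec, dotProduct_add, dotProduct_add, h2,
      Matrix.smul_mulVec, Matrix.one_mulVec, dotProduct_smul, smul_eq_mul]
    exact add_pos_of_nonneg_of_pos h3 (mul_pos (by exact_mod_cast mul_pos two_pos hδ) hw')

/-- A finite block matrix `x` that is positive, with positive image under `Q`, has positive image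
under `S`. -/
theorem re_sum_blockForm_nonneg {Ξ : Set (NcPoint V)} (hΞ : IsFullNcSet Ξ)
    {Q : GradedKernel V ℂ (N →L[ℂ] N)} (hQ : IsNcKernelOn Ξ Q) (hQherm : IsHermitianOn Ξ Q)
    {Ω Ω' : Set (NcPoint V)} (hΩ : Ω ⊆ strictPosDomain Ξ Q)
    (hΩ' : Ω' = fullEnvelope Ω ∩ strictPosDomain Ξ Q)
    {S : GradedKernel V ℂ (E →L[ℂ] E)} (hS : IsNcKernelOn Ω' S) (hSherm : IsHermitianOn Ω' S)
    (hSpos : ∀ Z ∈ Ω', BlockNonneg (S Z Z 1))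
    {κ : Type*} (s : Finset κ) (Z : κ → NcPoint V) (hZ : ∀ k, Z k ∈ Ω)
    (x : ∀ k l, Matrix (Fin (Z k).size) (Fin (Z l).size) ℂ)
    (hx : ∀ ν : ∀ k, Fin (Z k).size → ℂ, 0 ≤ (∑ k ∈ s, ∑ l ∈ s,
      blockForm ((x k l).map (algebraMap ℂ (ℂ →L[ℂ] ℂ))) (ν k) (ν l)).re)
    (hQx : ∀ ν : ∀ k, Fin (Z k).size → N, 0 ≤ (∑ k ∈ s, ∑ l ∈ s,
      blockForm (Q (Z k) (Z l) (x k l)) (ν k) (ν l)).re)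
    (y : ∀ k, Fin (Z k).size → E) :
    0 ≤ (∑ k ∈ s, ∑ l ∈ s, blockForm (S (Z k) (Z l) (x k l)) (y k) (y l)).re := by
  classical
  rcases s.eq_empty_or_nonempty with rfl | hs
  · simp
  obtain ⟨Z₀, hZ₀, J, hJ⟩ := (isFullNcSet_fullEnvelope Ω).exists_isOrthogonalSum Z hs
    fun k _ => subset_fullEnvelope Ω (hZ k)
  have hΩΞ : Ω ⊆ Ξ := fun Z hZ => (hΩ hZ).1
  have hZ₀Ξ : Z₀ ∈ Ξ := fullEnvelope_subset hΞ hΩΞ hZ₀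
  have hΩΩ' : Ω ⊆ Ω' := fun Z hZ => hΩ' ▸ ⟨subset_fullEnvelope Ω hZ, hΩ hZ⟩
  -- Finitely many points share a lower bound, which then passes to their orthogonal sum and puts
  -- `Z₀` in the strict positivity domain.
  obtain ⟨ε, hε, hεle⟩ : ∃ ε : ℝ, 0 < ε ∧ ∀ k ∈ s, ∀ ν,
      ε * sqNorm ν ≤ (blockForm (Q (Z k) (Z k) 1) ν ν).re := by
    choose e he hele using fun k => (hΩ (hZ k)).2.exists_re
    refine ⟨s.inf' hs e, by simpa using fun k _ => he k, fun k hk ν => le_trans ?_ (hele k ν)⟩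
    exact mul_le_mul_of_nonneg_right (Finset.inf'_le _ hk) (sqNorm_nonneg _)
  have hone : ∑ k ∈ s, mulRight (mulLeft (J k) 1) (J k).conjTranspose
      = (1 : Matrix (Fin Z₀.size) (Fin Z₀.size) ℂ) := by
    simpa [mulRight_mulLeft_eq_mul] using hJ.sum_eq_one
  have hnorm : ∀ ν : Fin Z₀.size → N,
      sqNorm ν = ∑ k ∈ s, sqNorm (act (J k).conjTranspose ν) := by
    intro ν
    have h1 : (1 : Matrix (Fin Z₀.size) (Fin Z₀.size) (N →L[ℂ] N)) =
        ∑ k ∈ s, mulRight (mulLeft (J k) 1) (J k).conjTranspose := by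
      simp only [mulRight_mulLeft_one]
      have := congrArg (Algebra.linearMap ℂ (N →L[ℂ] N)).mapMatrix hJ.sum_eq_one
      rw [map_sum] at this
      refine Eq.trans ?_ this.symm
      exact (Matrix.map_one _ (map_zero _) (map_one (algebraMap ℂ (N →L[ℂ] N)))).symm
    have h2 := blockForm_one ν
    rw [h1, blockForm_sum] at h2
    simp only [blockForm_mulRight_mulLeft, blockForm_one] at h2
    exact_mod_cast h2.symm
  have hQ1 : ∀ ν, ε * sqNorm ν ≤ (blockForm (Q Z₀ Z₀ 1) ν ν).re := by
    intro ν
    rw [← hone, map_sum, blockForm_sum, Complex.re_sum, hnorm, Finset.mul_sum]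
    refine Finset.sum_le_sum fun k hk => ?_
    rw [hQ.blockForm_eq (hΩΞ (hZ k)) hZ₀Ξ (hΩΞ (hZ k)) hZ₀Ξ (hJ.intertwines k hk)
      (hJ.intertwines k hk)]
    exact hεle k hk _
  have hZ₀' : Z₀ ∈ fullEnvelope Ω ∩ strictPosDomain Ξ Q :=
    ⟨hZ₀, hZ₀Ξ, blockStrictlyPos_of_re hQherm hZ₀Ξ hε hQ1⟩
  have hZ₀Ω' : Z₀ ∈ Ω' := hΩ' ▸ hZ₀'
  set G : Matrix (Fin Z₀.size) (Fin Z₀.size) ℂ :=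
    ∑ k ∈ s, ∑ l ∈ s, mulRight (mulLeft (J k) (x k l)) (J l).conjTranspose with hG
  have hQG : ∀ ν, 0 ≤ (blockForm (Q Z₀ Z₀ G) ν ν).re := by
    intro ν
    have := hQx fun k => act (J k).conjTranspose ν
    simp only [hG, map_sum, blockForm_sum]
    convert this using 2
    refine Finset.sum_congr rfl fun k hk => Finset.sum_congr rfl fun l hl => ?_
    rw [hQ.blockForm_eq (hΩΞ (hZ k)) hZ₀Ξ (hΩΞ (hZ l)) hZ₀Ξ (hJ.intertwines k hk)
      (hJ.intertwines l hl)]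
  have hSG : ∃ η : Fin Z₀.size → E, blockForm (S Z₀ Z₀ G) η η =
      ∑ k ∈ s, ∑ l ∈ s, blockForm (S (Z k) (Z l) (x k l)) (y k) (y l) := by
    -- Orthogonality of the isometries gives `J_k* η = y_k` for this column `η`.
    refine ⟨∑ k ∈ s, act (J k) (y k), ?_⟩
    have hη : ∀ k ∈ s, act (J k).conjTranspose (∑ k ∈ s, act (J k) (y k)) = y k := by
      intro k hk
      rw [act_sum, Finset.sum_eq_single k, ← act_mul, hJ.isometry k hk, act_one]
      · intro l hl hlk
        rw [← act_mul, hJ.orthogonal k hk l hl hlk.symm, act_zero]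
      · exact fun h => absurd hk h
    simp only [hG, map_sum, blockForm_sum]
    refine Finset.sum_congr rfl fun k hk => Finset.sum_congr rfl fun l hl => ?_
    rw [hS.blockForm_eq (hΩΩ' (hZ k)) hZ₀Ω' (hΩΩ' (hZ l)) hZ₀Ω' (hJ.intertwines k hk)
      (hJ.intertwines l hl), hη k hk, hη l hl]
  have hGre : ∀ w : Fin Z₀.size → ℂ, 0 ≤ (blockForm (G.map (algebraMap ℂ (ℂ →L[ℂ] ℂ))) w w).re := by
    intro w
    have := hx fun k => act (J k).conjTranspose w
    convert this using 2
    change mapBlockForm (Algebra.linearMap ℂ (ℂ →L[ℂ] ℂ)) w w G = _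
    simp only [hG, map_sum]
    refine Finset.sum_congr rfl fun k _ => Finset.sum_congr rfl fun l _ => ?_
    rw [mapBlockForm_mulRight_mulLeft]
    rfl
  obtain ⟨η, hη⟩ := hSG
  rw [← hη]
  -- The term `2δ` makes both the scalar matrix and its image under `Q` strictly positive; by
  -- Hermitian symmetry the adjoint part merely doubles the real part.
  have hpert : ∀ δ : ℝ, 0 < δ → 0 ≤ (blockForm (S Z₀ Z₀ G) η η).re +
      δ * (blockForm (S Z₀ Z₀ 1) η η).re := by
    intro δ hδ
    have hpos := posDef_add_conjTranspose_add hGre hδ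
    have := re_blockForm_nonneg_of_posDef hΞ (isFullNcSet_fullEnvelope Ω) hQ hQherm (hΩ' ▸ hS)
      (hΩ' ▸ hSpos) hZ₀' hpos (mul_pos hδ hε) (fun ν => by
        rw [hQherm.re_blockForm_eq hZ₀Ξ]
        nlinarith [hQG ν, hQ1 ν, sqNorm_nonneg ν, mul_le_mul_of_nonneg_left (hQ1 ν) hδ.le,
          mul_nonneg (mul_pos hδ hε).le (sqNorm_nonneg ν)]) η
    rw [hSherm.re_blockForm_eq hZ₀Ω'] at this
    linarith
  have h1 : 0 ≤ (blockForm (S Z₀ Z₀ 1) η η).re := (Complex.le_def.1 (hSpos _ hZ₀Ω' _)).1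
  refine le_of_forall_pos_le_add fun e he => ?_
  have := hpert (e / ((blockForm (S Z₀ Z₀ 1) η η).re + 1)) (by positivity)
  refine this.trans ?_
  gcongr
  rw [div_mul_eq_mul_div, div_le_iff₀ (by positivity)]
  nlinarith

end Positivity

/-! ### Splitting a functional by the Riesz extension theorem. -/

section Extension

/-- The cone on which a family of linear functionals has nonnegative real part. -/
def dualCone {I X : Type*} [AddCommGroup X] [Module ℂ X] (f : I → X →ₗ[ℂ] ℂ) :
    PointedCone ℝ X where
  carrier := {x | ∀ i, 0 ≤ (f i x).re}
  zero_mem' i := by simp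
  add_mem' hx hy i := by
    simpa using add_nonneg (hx i) (hy i)
  smul_mem' r x hx i := by
    have h : r • x = ((r : ℝ) : ℂ) • x := rfl
    rw [h, map_smul, smul_eq_mul, Complex.re_ofReal_mul]
    exact mul_nonneg r.2 (hx i)

/-- A functional that is positive on `{y | y ≥ 0, q y ≥ 0}` is of the form `Λ₁ ∘ q + Λ₂` with
positive `Λ₁`, `Λ₂`, provided that there are enough interior points. -/
theorem exists_positive_decomposition {I J X Y : Type*} [AddCommGroup X] [Module ℂ X]
    [AddCommGroup Y] [Module ℂ Y] (f : I → X →ₗ[ℂ] ℂ) (g : J → Y →ₗ[ℂ] ℂ) (q : Y →ₗ[ℂ] X)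
    (s : Y →ₗ[ℂ] ℂ)
    (hs : ∀ y, (∀ i, 0 ≤ (f i (q y)).re) → (∀ j, 0 ≤ (g j y).re) → 0 ≤ (s y).re)
    (hX : ∀ x, ∃ y, (∀ i, 0 ≤ (f i (q y + x)).re) ∧ ∀ j, 0 ≤ (g j y).re)
    (hY : ∀ z, ∃ y, (∀ i, 0 ≤ (f i (q y)).re) ∧ ∀ j, 0 ≤ (g j (y + z)).re) :
    ∃ (Λ₁ : X →ₗ[ℂ] ℂ) (Λ₂ : Y →ₗ[ℂ] ℂ), (∀ y, Λ₁ (q y) + Λ₂ y = s y) ∧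
      (∀ x, (∀ i, 0 ≤ (f i x).re) → 0 ≤ (Λ₁ x).re) ∧
      (∀ y, (∀ j, 0 ≤ (g j y).re) → 0 ≤ (Λ₂ y).re) := by
  let fg : I ⊕ J → X × Y →ₗ[ℂ] ℂ :=
    Sum.elim (fun i => f i ∘ₗ LinearMap.fst ℂ X Y) fun j => g j ∘ₗ LinearMap.snd ℂ X Y
  -- The real functional `Re s` on the graph of `q`. An extension to `X × Y` that is positive on the
  -- product cone has two positive components, which will be `Λ₁` and `Λ₂`.
  let φ : X × Y →ₗ.[ℝ] ℝ :=
    { domain := LinearMap.range ((q.prod LinearMap.id).restrictScalars ℝ)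
      toFun := (Complex.reLm ∘ₗ (s ∘ₗ LinearMap.snd ℂ X Y).restrictScalars ℝ) ∘ₗ
        Submodule.subtype _ }
  obtain ⟨ψ, hψ, hpos⟩ := riesz_extension (dualCone fg) φ
    (by
      rintro ⟨_, y, rfl⟩ hy
      exact hs y (fun i => hy (Sum.inl i)) fun j => hy (Sum.inr j))
    (by
      rintro ⟨x, z⟩
      obtain ⟨y, hy, hy'⟩ := hX x
      obtain ⟨w, hw, hw'⟩ := hY z
      refine ⟨⟨_, y + w, rfl⟩, ?_⟩
      rintro (i | j)
      · have := add_nonneg (hy i) (hw i)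
        rw [← Complex.add_re, ← map_add] at this
        change 0 ≤ (f i (q (y + w) + x)).re
        rwa [map_add q, add_right_comm]
      · have := add_nonneg (hy' j) (hw' j)
        rw [← Complex.add_re, ← map_add] at this
        change 0 ≤ (g j (y + w + z)).re
        rwa [add_assoc])
  let Λ : X × Y →ₗ[ℂ] ℂ := Module.Dual.extendRCLike ψ
  have hΛ : ∀ x, (Λ x).re = ψ x := fun x =>
    Module.Dual.re_extendRCLike_apply (𝕜 := ℂ) ψ x
  refine ⟨Λ ∘ₗ LinearMap.inl ℂ X Y, Λ ∘ₗ LinearMap.inr ℂ X Y, fun y => ?_, fun x hx => ?_,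
    fun y hy => ?_⟩
  -- Both sides are complex linear, so equality of real parts at `y` and at `I • y` gives equality.
  · have key : ∀ y, (Λ (q y, y)).re = (s y).re := fun y => by
      rw [hΛ]
      exact hψ ⟨_, y, rfl⟩
    have h1 : Λ (q y, y) = s y := by
      refine Complex.ext (key y) ?_
      have := key (Complex.I • y)
      rw [map_smul, ← Prod.smul_mk, map_smul, map_smul] at this
      simpa using this
    rw [← h1, LinearMap.comp_apply, LinearMap.comp_apply, ← map_add]
    simp
  · rw [LinearMap.comp_apply, hΛ]
    refine hpos _ ?_
    rintro (i | j)
    · exact hx i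
    · simp [fg]
  · rw [LinearMap.comp_apply, hΛ]
    refine hpos _ ?_
    rintro (i | j)
    · simp [fg]
    · exact hy j

end Extension

/-! ### Block families, their quadratic forms and positive functionals. -/

section BlockFamilies

variable {V : Type*} {Ω : Set (NcPoint V)} {E : Type*} {A : Type*}

/-- A point of `Ω` together with a column of vectors of the same length. -/
abbrev VecPoint (Ω : Set (NcPoint V)) (E : Type*) := Σ Z : Ω, (Fin Z.1.size → E)

/-- Finitely supported families of matrices, with a block for every pair of points with vectors. -/
abbrev BlockFamily (Ω : Set (NcPoint V)) (E A : Type*) [AddCommGroup A] :=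
  Π₀ kl : VecPoint Ω E × VecPoint Ω E, Matrix (Fin kl.1.1.1.size) (Fin kl.2.1.1.size) A

variable [AddCommGroup A] [Module ℂ A]

open Classical in
/-- The family with the single block `P` at the place `(k, l)`. -/
noncomputable def block (k l : VecPoint Ω E) :
    Matrix (Fin k.1.1.size) (Fin l.1.1.size) A →ₗ[ℂ] BlockFamily Ω E A :=
  DFinsupp.lsingle (R := ℂ)
    (M := fun kl : VecPoint Ω E × VecPoint Ω E =>
      Matrix (Fin kl.1.1.1.size) (Fin kl.2.1.1.size) A) (k, l)

open Classical in
/-- A functional on block families, given blockwise. -/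
noncomputable def blockSum
    (f : ∀ k l : VecPoint Ω E, Matrix (Fin k.1.1.size) (Fin l.1.1.size) A →ₗ[ℂ] ℂ) :
    BlockFamily Ω E A →ₗ[ℂ] ℂ :=
  DFinsupp.lsum ℂ fun kl => f kl.1 kl.2

theorem blockSum_block
    (f : ∀ k l : VecPoint Ω E, Matrix (Fin k.1.1.size) (Fin l.1.1.size) A →ₗ[ℂ] ℂ)
    (k l : VecPoint Ω E) (P : Matrix (Fin k.1.1.size) (Fin l.1.1.size) A) :
    blockSum f (block k l P) = f k l P := by
  classical
  exact DFinsupp.lsum_single _ _ _ _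

variable {H : Type*} [NormedAddCommGroup H] [InnerProductSpace ℂ H]

/-- The quadratic form of a block family at a family of columns of vectors. -/
noncomputable def quadForm (π : A →ₗ[ℂ] (H →L[ℂ] H)) (ν : ∀ k : VecPoint Ω E, Fin k.1.1.size → H) :
    BlockFamily Ω E A →ₗ[ℂ] ℂ :=
  blockSum fun k l => mapBlockForm π (ν k) (ν l)

theorem quadForm_block (π : A →ₗ[ℂ] (H →L[ℂ] H)) (ν : ∀ k : VecPoint Ω E, Fin k.1.1.size → H)
    (k l : VecPoint Ω E) (P : Matrix (Fin k.1.1.size) (Fin l.1.1.size) A) :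
    quadForm π ν (block k l P) = mapBlockForm π (ν k) (ν l) P :=
  blockSum_block _ k l P

/-- Functionals with nonnegative real part at the families with accretive quadratic form. -/
def IsPositiveFunctional (π : A →ₗ[ℂ] (H →L[ℂ] H)) (Λ : BlockFamily Ω E A →ₗ[ℂ] ℂ) : Prop :=
  ∀ m, (∀ ν, 0 ≤ (quadForm π ν m).re) → 0 ≤ (Λ m).re

end BlockFamilies

/-- The rank one matrix `a* b`. -/
def rowProd {A : Type*} [Mul A] [Star A] {n m : ℕ} (a : Fin n → A) (b : Fin m → A) :
    Matrix (Fin n) (Fin m) A :=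
  Matrix.of fun p q => star (a p) * b q

section Functionals

variable {V : Type*} [AddCommGroup V] [Module ℂ V] {Ω : Set (NcPoint V)}
  {E : Type*} [NormedAddCommGroup E] [InnerProductSpace ℂ E] [CompleteSpace E]
  {A : Type*} [CStarAlgebra A]
  {H : Type*} [NormedAddCommGroup H] [InnerProductSpace ℂ H] [CompleteSpace H]

/-- The bound on the functional along families of intertwiners starting at a given point. -/
def IsBoundedFunctional (Λ : BlockFamily Ω E A →ₗ[ℂ] ℂ) : Prop :=
  ∀ W ∈ Ω, ∃ C : ℝ, 0 ≤ C ∧ ∀ (ι : Type) [Fintype ι] (k : ι → VecPoint Ω E)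
    (u : ∀ i, Matrix (Fin (k i).1.1.size) (Fin W.size) ℂ),
    (∀ i, Intertwines W (k i).1.1 (u i)) →
      (Λ (∑ i, ∑ j, block (k i) (k j)
        (mulRight (mulLeft (u i) (1 : Matrix (Fin W.size) (Fin W.size) A))
          (u j).conjTranspose))).re ≤ C * sqNorm (∑ i, act (u i).conjTranspose (k i).2)

/-- The linear map underlying a representation. -/
def repLin (π : A →⋆ₐ[ℂ] (H →L[ℂ] H)) : A →ₗ[ℂ] (H →L[ℂ] H) := π.toAlgHom.toLinearMap

theorem mapBlockForm_repLin_conjTranspose (π : A →⋆ₐ[ℂ] (H →L[ℂ] H)) {n m : ℕ}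
    (x : Fin n → H) (y : Fin m → H) (P : Matrix (Fin n) (Fin m) A) :
    mapBlockForm (repLin π) y x P.conjTranspose = star (mapBlockForm (repLin π) x y P) := by
  rw [mapBlockForm_apply, mapBlockForm_apply, ← blockForm_conjTranspose]
  congr 1
  ext1 p q
  exact map_star π (P q p)

theorem mapBlockForm_one (π : A →⋆ₐ[ℂ] (H →L[ℂ] H)) {n : ℕ} (x : Fin n → H) :
    mapBlockForm (repLin π) x x 1 = (sqNorm x : ℂ) := by
  rw [← blockForm_one, mapBlockForm_apply]
  congr 1
  exact Matrix.map_one _ (map_zero _) (map_one π)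

/-- This Gram identity is why families of blocks `a_i* a_j` are accretive, hence why positive
functionals yield complete positivity. -/
theorem mapBlockForm_rowProd (π : A →⋆ₐ[ℂ] (H →L[ℂ] H)) {n m : ℕ} (x : Fin n → H)
    (y : Fin m → H) (a : Fin n → A) (b : Fin m → A) :
    mapBlockForm (repLin π) x y (rowProd a b) =
      inner ℂ (∑ p, π (a p) (x p)) (∑ q, π (b q) (y q)) := by
  rw [mapBlockForm_apply, blockForm, sum_inner]
  refine Finset.sum_congr rfl fun p _ => ?_
  rw [inner_sum]
  refine Finset.sum_congr rfl fun q _ => ?_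
  change inner ℂ (x p) (π (star (a p) * b q) (y q)) = _
  rw [map_mul, map_star, ContinuousLinearMap.star_eq_adjoint, mul_apply_eq_comp,
    ContinuousLinearMap.adjoint_inner_right]

theorem norm_sq_le_mul_of_forall {a b : ℝ} {X : ℂ} (ha : 0 ≤ a) (hb : 0 ≤ b)
    (h : ∀ c : ℂ, 0 ≤ ‖c‖ ^ 2 * a + 2 * (star c * X).re + b) : ‖X‖ ^ 2 ≤ a * b := by
  rcases eq_or_ne X 0 with rfl | hX
  · simpa using mul_nonneg ha hb
  have hX2 : 0 < ‖X‖ ^ 2 := by positivity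
  have hd := discrim_le_zero (a := ‖X‖ ^ 2 * a) (b := 2 * ‖X‖ ^ 2) (c := b) fun t => by
    -- The phase of `X` turns the cross term into `2 t ‖X‖²`, leaving a real quadratic in `t` whose
    -- discriminant is at most zero.
    have := h (t * X)
    have h1 : star ((t : ℂ) * X) * X = ((t * ‖X‖ ^ 2 : ℝ) : ℂ) := by
      rw [star_mul', RCLike.star_def, Complex.conj_ofReal, mul_assoc,
        Complex.conj_mul']
      push_cast
      rfl
    rw [h1, Complex.ofReal_re, norm_mul, mul_pow, Complex.norm_real, Real.norm_eq_abs,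
      sq_abs] at this
    nlinarith
  rw [discrim] at hd
  have : ‖X‖ ^ 2 * ‖X‖ ^ 2 ≤ ‖X‖ ^ 2 * (a * b) := by nlinarith
  exact le_of_mul_le_mul_left this hX2

namespace IsPositiveFunctional

variable {π : A →⋆ₐ[ℂ] (H →L[ℂ] H)} {Λ : BlockFamily Ω E A →ₗ[ℂ] ℂ}

theorem re_eq_zero (hΛ : IsPositiveFunctional (repLin π) Λ)
    {m : BlockFamily Ω E A}
    (hm : ∀ ν, (quadForm (repLin π) ν m).re = 0) : (Λ m).re = 0 := by
  refine le_antisymm ?_ (hΛ m fun ν => (hm ν).ge)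
  have := hΛ (-m) fun ν => by rw [map_neg, Complex.neg_re, hm, neg_zero]
  rw [map_neg, Complex.neg_re] at this
  linarith

/-- The family `c P` at `(k, l)` minus `c̄ P*` at `(l, k)` has purely imaginary quadratic form, so
the real part of `Λ` kills it; take `c = 1` and `c = I`. -/
theorem conjTranspose (hΛ : IsPositiveFunctional (repLin π) Λ) (k l : VecPoint Ω E)
    (P : Matrix (Fin k.1.1.size) (Fin l.1.1.size) A) :
    Λ (block l k P.conjTranspose) = star (Λ (block k l P)) := by
  have key : ∀ c : ℂ, (c * Λ (block k l P)).re = (star c * Λ (block l k P.conjTranspose)).re := by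
    intro c
    have := hΛ.re_eq_zero (m := c • block k l P - star c • block l k P.conjTranspose) fun ν => by
      rw [map_sub, map_smul, map_smul, quadForm_block, quadForm_block,
        mapBlockForm_repLin_conjTranspose, smul_eq_mul, smul_eq_mul, ← star_mul', Complex.sub_re,
        RCLike.star_def, Complex.conj_re, sub_self]
    rw [map_sub, map_smul, map_smul, Complex.sub_re] at this
    exact sub_eq_zero.1 this
  have h1 := key 1
  have h2 := key Complex.I
  simp at h1 h2
  refine Complex.ext ?_ ?_ <;> simp <;> linarith

theorem re_sum_rowProd_nonneg (hΛ : IsPositiveFunctional (repLin π) Λ) {ι : Type*} [Fintype ι]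
    (k : ι → VecPoint Ω E) (a : ∀ i, Fin (k i).1.1.size → A) :
    0 ≤ (∑ i, ∑ j, Λ (block (k i) (k j) (rowProd (a i) (a j)))).re := by
  simp only [← map_sum]
  refine hΛ _ fun ν => ?_
  simp only [map_sum, quadForm_block, mapBlockForm_rowProd]
  simp only [← inner_sum, ← sum_inner]
  exact inner_self_nonneg (𝕜 := ℂ)

theorem rowProd_conjTranspose {n m : ℕ} (a : Fin n → A) (b : Fin m → A) :
    (rowProd a b).conjTranspose = rowProd b a := by
  ext p q
  simp [rowProd]

theorem rowProd_smul_left {n m : ℕ} (c : ℂ) (a : Fin n → A) (b : Fin m → A) :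
    rowProd (c • a) b = star c • rowProd a b := by
  ext p q
  simp [rowProd]

theorem rowProd_smul_right {n m : ℕ} (c : ℂ) (a : Fin n → A) (b : Fin m → A) :
    rowProd a (c • b) = c • rowProd a b := by
  ext p q
  simp [rowProd]

/-- Cauchy–Schwarz for the semidefinite form `(a, b) ↦ Λ(a* b)`: adjoin `k₀`, with row `c • a`, to
the family and vary `c`. -/
theorem norm_sq_sum_rowProd_le (hΛ : IsPositiveFunctional (repLin π) Λ) {ι : Type*} [Fintype ι]
    (k₀ : VecPoint Ω E) (a : Fin k₀.1.1.size → A) (k : ι → VecPoint Ω E)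
    (b : ∀ i, Fin (k i).1.1.size → A) :
    ‖∑ j, Λ (block k₀ (k j) (rowProd a (b j)))‖ ^ 2 ≤
      (Λ (block k₀ k₀ (rowProd a a))).re *
        (∑ i, ∑ j, Λ (block (k i) (k j) (rowProd (b i) (b j)))).re := by
  refine norm_sq_le_mul_of_forall ?_ (hΛ.re_sum_rowProd_nonneg k b) fun c => ?_
  · simpa using hΛ.re_sum_rowProd_nonneg (fun _ : Unit => k₀) fun _ => a
  have h : 0 ≤ (Λ (block k₀ k₀ (rowProd (c • a) (c • a))) +
      ∑ j, Λ (block k₀ (k j) (rowProd (c • a) (b j))) +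
      ∑ i, (Λ (block (k i) k₀ (rowProd (b i) (c • a))) +
        ∑ j, Λ (block (k i) (k j) (rowProd (b i) (b j))))).re := by
    have h := hΛ.re_sum_rowProd_nonneg (ι := Option ι) (fun i => i.elim k₀ k)
      (fun i => match i with
        | none => c • a
        | some i => b i)
    simp only [Fintype.sum_option] at h
    exact h
  simp only [rowProd_smul_left, rowProd_smul_right, map_smul, smul_eq_mul, Finset.sum_add_distrib,
    ← Finset.mul_sum] at h
  have h1 : ∑ i, Λ (block (k i) k₀ (rowProd (b i) a)) =
      star (∑ j, Λ (block k₀ (k j) (rowProd a (b j)))) := by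
    rw [star_sum]
    refine Finset.sum_congr rfl fun i _ => ?_
    rw [← hΛ.conjTranspose, rowProd_conjTranspose]
  have h2 : c * (star c * Λ (block k₀ k₀ (rowProd a a))) =
      ((‖c‖ ^ 2 : ℝ) : ℂ) * Λ (block k₀ k₀ (rowProd a a)) := by
    rw [← mul_assoc, RCLike.star_def, Complex.mul_conj']
    push_cast
    rfl
  rw [h1, h2] at h
  simp only [Complex.add_re, Complex.re_ofReal_mul] at h
  have h3 : (c * star (∑ j, Λ (block k₀ (k j) (rowProd a (b j))))).re =
      (star c * ∑ j, Λ (block k₀ (k j) (rowProd a (b j)))).re := by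
    rw [← Complex.conj_re, ← RCLike.star_def, star_mul', star_star]
  rw [h3] at h
  linarith

/-- Positivity of `Λ` applied to `‖T‖² I` minus the block with `T* T` in one diagonal place, which
is accretive because `π` is contractive. -/
theorem re_block_rowProd_single_le (hΛ : IsPositiveFunctional (repLin π) Λ) (k : VecPoint Ω E)
    (p : Fin k.1.1.size) (T : A) :
    (Λ (block k k (rowProd (Pi.single p T) (Pi.single p T)))).re ≤
      ‖T‖ ^ 2 * (Λ (block k k 1)).re := by
  have h := hΛ (((‖T‖ ^ 2 : ℝ) : ℂ) • block k k (1 : Matrix (Fin k.1.1.size) (Fin k.1.1.size) A) -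
    block k k (rowProd (Pi.single p T) (Pi.single p T))) fun ν => by
      rw [map_sub, map_smul, quadForm_block, quadForm_block, mapBlockForm_rowProd,
        Finset.sum_eq_single p, Pi.single_eq_same]
      · rw [mapBlockForm_one, inner_self_eq_norm_sq_to_K, smul_eq_mul]
        have h2 : ‖π T (ν k p)‖ ≤ ‖T‖ * ‖ν k p‖ :=
          ((π T).le_opNorm _).trans (by gcongr; exact NonUnitalStarAlgHom.norm_apply_le π T)
        have h3 : ‖ν k p‖ ^ 2 ≤ sqNorm (ν k) :=
          Finset.single_le_sum (f := fun p => ‖ν k p‖ ^ 2) (fun _ _ => by positivity)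
            (Finset.mem_univ p)
        have h4 : ‖π T (ν k p)‖ ^ 2 ≤ ‖T‖ ^ 2 * sqNorm (ν k) :=
          calc _ ≤ (‖T‖ * ‖ν k p‖) ^ 2 := by gcongr
            _ ≤ _ := by rw [mul_pow]; gcongr
        have h5 : (((‖T‖ ^ 2 : ℝ) : ℂ) * (sqNorm (ν k) : ℂ) - (‖π T (ν k p)‖ : ℂ) ^ 2) =
          ((‖T‖ ^ 2 * sqNorm (ν k) - ‖π T (ν k p)‖ ^ 2 : ℝ) : ℂ) := by push_cast; rfl
        refine le_of_le_of_eq (sub_nonneg.2 h4) ?_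
        exact (congrArg Complex.re h5).symm
      · intro q _ hq
        simp [Pi.single_eq_of_ne hq]
      · simp
  rw [map_sub, map_smul, smul_eq_mul, Complex.sub_re, Complex.re_ofReal_mul] at h
  linarith

/-- The basic estimate: the functional depends on a combination of vectors, transported by
intertwiners to a common point, only through their sum. -/
theorem norm_sq_sum_le (hΛ : IsPositiveFunctional (repLin π) Λ) (hbd : IsBoundedFunctional Λ)
    {Z W : NcPoint V} (hZ : Z ∈ Ω) (hW : W ∈ Ω) :
    ∃ C : ℝ, 0 ≤ C ∧ ∀ (ι : Type) [Fintype ι] (x : Fin Z.size → E) (k : ι → VecPoint Ω E)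
      (u : ∀ i, Matrix (Fin (k i).1.1.size) (Fin W.size) ℂ),
      (∀ i, Intertwines W (k i).1.1 (u i)) → ∀ (p : Fin Z.size) (q : Fin W.size) (T : A),
        ‖∑ j, Λ (block ⟨⟨Z, hZ⟩, x⟩ (k j)
          (mulRight (Matrix.single p q T) (u j).conjTranspose))‖ ^ 2 ≤
          C * ‖T‖ ^ 2 * sqNorm x * sqNorm (∑ i, act (u i).conjTranspose (k i).2) := by
  obtain ⟨C₁, hC₁, h₁⟩ := hbd Z hZ
  obtain ⟨C₂, hC₂, h₂⟩ := hbd W hW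
  refine ⟨C₁ * C₂, mul_nonneg hC₁ hC₂, fun ι _ x k u hu p q T => ?_⟩
  set k₀ : VecPoint Ω E := ⟨⟨Z, hZ⟩, x⟩ with hk₀
  -- The conjugated `q`-th column of `u i`, as a row over `A`. Summing the products of these rows
  -- over `q` gives `u_i u_j*`, and a matrix unit times `u_j*` selects a single `q`.
  let b : ∀ (q : Fin W.size) (i : ι), Fin (k i).1.1.size → A := fun q i r =>
    algebraMap ℂ A (star (u i r q))
  have h3 : ∀ j, mulRight (Matrix.single p q T) (u j).conjTranspose =
      rowProd (Pi.single p (star T)) (b q j) := by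
    intro j
    ext p' r
    rw [mulRight, Matrix.of_apply, Finset.sum_eq_single q]
    · by_cases hp : p' = p
      · subst hp
        simp [rowProd, b, Algebra.algebraMap_eq_smul_one]
      · simp [rowProd, Ne.symm hp]
    · intro q' _ hq'
      simp [Ne.symm hq']
    · simp
  simp only [h3]
  refine (hΛ.norm_sq_sum_rowProd_le k₀ _ k (b q)).trans ?_
  have h4 : (Λ (block k₀ k₀ (rowProd (Pi.single p (star T)) (Pi.single p (star T))))).re ≤
      ‖T‖ ^ 2 * (C₁ * sqNorm x) := by
    refine (hΛ.re_block_rowProd_single_le k₀ p (star T)).trans ?_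
    rw [norm_star]
    gcongr
    have := h₁ Unit (fun _ => k₀) (fun _ => 1) fun _ => intertwines_one Z
    simpa [mulLeft_one, mulRight_one, hk₀] using this
  have h5 : (∑ i, ∑ j, Λ (block (k i) (k j) (rowProd (b q i) (b q j)))).re ≤
      C₂ * sqNorm (∑ i, act (u i).conjTranspose (k i).2) := by
    refine le_trans ?_ (h₂ ι k u hu)
    have h6 : ∀ i j, mulRight (mulLeft (u i) (1 : Matrix (Fin W.size) (Fin W.size) A))
        (u j).conjTranspose = ∑ q, rowProd (b q i) (b q j) := by
      intro i j
      rw [mulRight_mulLeft_one]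
      ext r t
      simp [Matrix.sum_apply, rowProd, b, Matrix.mul_apply, ← algebraMap_star_comm]
    rw [map_sum]
    simp only [h6, map_sum]
    have h7 : ∑ i, ∑ j, ∑ q, Λ (block (k i) (k j) (rowProd (b q i) (b q j))) =
        ∑ q, ∑ i, ∑ j, Λ (block (k i) (k j) (rowProd (b q i) (b q j))) := by
      rw [Finset.sum_comm]
      conv_rhs => rw [Finset.sum_comm]; enter [2, i]; rw [Finset.sum_comm]
      rw [Finset.sum_comm]
    refine le_of_le_of_eq ?_ ((congrArg Complex.re h7).trans (Complex.re_sum _ _)).symm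
    -- Every column contributes a nonnegative term, so one of them is at most the whole Gram sum.
    exact Finset.single_le_sum (f := fun q =>
      (∑ i, ∑ j, Λ (block (k i) (k j) (rowProd (b q i) (b q j)))).re)
      (fun q _ => hΛ.re_sum_rowProd_nonneg k (b q)) (Finset.mem_univ q)
  calc _ ≤ (‖T‖ ^ 2 * (C₁ * sqNorm x)) * (C₂ * sqNorm (∑ i, act (u i).conjTranspose (k i).2)) :=
        mul_le_mul h4 h5 (hΛ.re_sum_rowProd_nonneg k (b q))
          (mul_nonneg (by positivity) (mul_nonneg hC₁ (sqNorm_nonneg _)))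
    _ = _ := by ring

end IsPositiveFunctional

end Functionals

/-! ### Operators from bounded forms. -/

section Forms

variable {E : Type*} [NormedAddCommGroup E] [InnerProductSpace ℂ E] [CompleteSpace E]
  {A : Type*} [NormedAddCommGroup A] [NormedSpace ℂ A]

theorem exists_clm_of_form (b : E → E → ℂ) (hadd : ∀ e f f', b e (f + f') = b e f + b e f')
    (hsmul : ∀ e (c : ℂ) f, b e (c • f) = c * b e f)
    (hadd' : ∀ e e' f, b (e + e') f = b e f + b e' f)
    (hsmul' : ∀ (c : ℂ) e f, b (c • e) f = star c * b e f) {C : ℝ} (hC : 0 ≤ C)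
    (hb : ∀ e f, ‖b e f‖ ≤ C * ‖e‖ * ‖f‖) :
    ∃ T : E →L[ℂ] E, ‖T‖ ≤ C ∧ ∀ e f, inner ℂ e (T f) = b e f := by
  let B : E →L⋆[ℂ] E →L[ℂ] ℂ := LinearMap.mkContinuous₂
    (LinearMap.mk₂'ₛₗ (starRingEnd ℂ) (RingHom.id ℂ) (fun f e => star (b e f))
      (fun f f' e => by rw [hadd, star_add])
      (fun c f e => by rw [hsmul, star_mul']; rfl)
      (fun f e e' => by rw [hadd', star_add])
      (fun c f e => by rw [hsmul', star_mul', star_star]; rfl)) C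
    (fun f e => by
      rw [LinearMap.mk₂'ₛₗ_apply, norm_star]
      exact (hb e f).trans (by ring_nf; rfl))
  have hT : ∀ e f, inner ℂ e (InnerProductSpace.continuousLinearMapOfBilin B f) = b e f := by
    intro e f
    rw [← inner_conj_symm, InnerProductSpace.continuousLinearMapOfBilin_apply]
    exact star_star (b e f)
  refine ⟨InnerProductSpace.continuousLinearMapOfBilin B, ?_, hT⟩
  refine ContinuousLinearMap.opNorm_le_bound _ hC fun f => ?_
  set T := InnerProductSpace.continuousLinearMapOfBilin B with hTdef
  -- Testing the form at `e = T f` gives `‖T f‖² ≤ C ‖T f‖ ‖f‖`, hence the norm bound.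
  have h1 := hb (T f) f
  have h2 : ‖inner ℂ (T f) (T f)‖ = ‖T f‖ * ‖T f‖ := by
    rw [inner_self_eq_norm_sq_to_K, norm_pow, RCLike.norm_ofReal, abs_norm, sq]
  rw [← hT, h2] at h1
  rcases (norm_nonneg (T f)).eq_or_lt with h0 | h0
  · rw [← h0]; positivity
  · have : ‖T f‖ * ‖T f‖ ≤ ‖T f‖ * (C * ‖f‖) := by nlinarith
    exact le_of_mul_le_mul_left this h0

theorem exists_clm_of_trilinear (b : A → E → E → ℂ)
    (hA : ∀ T T' e f, b (T + T') e f = b T e f + b T' e f)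
    (hA' : ∀ (c : ℂ) T e f, b (c • T) e f = c * b T e f)
    (hadd : ∀ T e f f', b T e (f + f') = b T e f + b T e f')
    (hsmul : ∀ T e (c : ℂ) f, b T e (c • f) = c * b T e f)
    (hadd' : ∀ T e e' f, b T (e + e') f = b T e f + b T e' f)
    (hsmul' : ∀ T (c : ℂ) e f, b T (c • e) f = star c * b T e f) {C : ℝ} (hC : 0 ≤ C)
    (hb : ∀ T e f, ‖b T e f‖ ≤ C * ‖T‖ * ‖e‖ * ‖f‖) :
    ∃ G : A →L[ℂ] (E →L[ℂ] E), ∀ T e f, inner ℂ e (G T f) = b T e f := by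
  choose G hG hGb using fun T => exists_clm_of_form (b T) (hadd T) (hsmul T) (hadd' T) (hsmul' T)
    (mul_nonneg hC (norm_nonneg T)) (hb T)
  refine ⟨LinearMap.mkContinuous
    { toFun := G
      map_add' := fun T T' => ?_
      map_smul' := fun c T => ?_ } C hG, hGb⟩
  · refine ContinuousLinearMap.ext fun f => ext_inner_left ℂ fun e => ?_
    rw [add_apply, inner_add_right, hGb, hGb, hGb, hA]
  · refine ContinuousLinearMap.ext fun f => ext_inner_left ℂ fun e => ?_
    rw [RingHom.id_apply, smul_apply, inner_smul_right, hGb, hGb, hA']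

end Forms

/-! ### Representing positive bounded functionals by cp kernels. -/

section Functionals

variable {V : Type*} [AddCommGroup V] [Module ℂ V] {Ω : Set (NcPoint V)}
  {E : Type*} [NormedAddCommGroup E] [InnerProductSpace ℂ E] [CompleteSpace E]
  {A : Type*} [CStarAlgebra A]
  {H : Type*} [NormedAddCommGroup H] [InnerProductSpace ℂ H] [CompleteSpace H]

namespace IsPositiveFunctional

variable {π : A →⋆ₐ[ℂ] (H →L[ℂ] H)} {Λ : BlockFamily Ω E A →ₗ[ℂ] ℂ}

/-- The right side of `norm_sq_sum_le` vanishes along such a relation; apply it to each entry of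
`P`. Linearity in the vectors and compatibility with intertwinings are both instances of this. -/
theorem sum_eq_zero (hΛ : IsPositiveFunctional (repLin π) Λ) (hbd : IsBoundedFunctional Λ)
    (k₀ : VecPoint Ω E) {W : NcPoint V} (hW : W ∈ Ω) {ι : Type} [Fintype ι]
    (k : ι → VecPoint Ω E) (u : ∀ i, Matrix (Fin (k i).1.1.size) (Fin W.size) ℂ)
    (hu : ∀ i, Intertwines W (k i).1.1 (u i)) (h : ∑ i, act (u i).conjTranspose (k i).2 = 0)
    (P : Matrix (Fin k₀.1.1.size) (Fin W.size) A) :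
    ∑ j, Λ (block k₀ (k j) (mulRight P (u j).conjTranspose)) = 0 := by
  obtain ⟨C, -, hC⟩ := hΛ.norm_sq_sum_le hbd k₀.1.2 hW
  rw [Matrix.matrix_eq_sum_single P]
  simp only [mulRight_sum, map_sum]
  rw [Finset.sum_comm]
  refine Finset.sum_eq_zero fun p _ => ?_
  rw [Finset.sum_comm]
  refine Finset.sum_eq_zero fun q _ => ?_
  have := hC ι k₀.2 k u hu p q (P p q)
  rw [h, sqNorm_zero, mul_zero] at this
  exact norm_eq_zero.1 (pow_eq_zero_iff two_ne_zero |>.1 (le_antisymm this (by positivity)))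

theorem block_sum_right (hΛ : IsPositiveFunctional (repLin π) Λ) (hbd : IsBoundedFunctional Λ)
    (k₀ : VecPoint Ω E) (W : Ω) {ι : Type} [Fintype ι] (c : ι → ℂ) (w : ι → Fin W.1.size → E)
    (P : Matrix (Fin k₀.1.1.size) (Fin W.1.size) A) :
    Λ (block k₀ ⟨W, ∑ i, c i • w i⟩ P) = ∑ i, c i * Λ (block k₀ ⟨W, w i⟩ P) := by
  -- The relation is `-(∑ c_i w_i) + ∑ c_i w_i = 0` at `W`. The scalars are starred because vectors
  -- are transported by the adjoints of the intertwiners.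
  have h := hΛ.sum_eq_zero hbd k₀ W.2 (ι := Option ι)
    (fun i => ⟨W, i.elim (∑ i, c i • w i) w⟩)
    (fun i => (star (i.elim (-1) c)) • (1 : Matrix (Fin W.1.size) (Fin W.1.size) ℂ))
    (fun i => intertwines_smul_one W.1 _) (by
      simp only [Matrix.conjTranspose_smul, Matrix.conjTranspose_one, star_star, act_smul_one,
        Fintype.sum_option, Option.elim_none, Option.elim_some]
      simp) P
  simp only [Matrix.conjTranspose_smul, Matrix.conjTranspose_one, star_star, mulRight_smul_one,
    Fintype.sum_option, Option.elim_none, Option.elim_some, map_smul, smul_eq_mul] at h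
  linear_combination -h

theorem block_sum_left (hΛ : IsPositiveFunctional (repLin π) Λ) (hbd : IsBoundedFunctional Λ)
    (k₀ : VecPoint Ω E) (W : Ω) {ι : Type} [Fintype ι] (c : ι → ℂ) (w : ι → Fin W.1.size → E)
    (P : Matrix (Fin W.1.size) (Fin k₀.1.1.size) A) :
    Λ (block ⟨W, ∑ i, c i • w i⟩ k₀ P) = ∑ i, star (c i) * Λ (block ⟨W, w i⟩ k₀ P) := by
  have h := congrArg star (hΛ.block_sum_right hbd k₀ W c w P.conjTranspose)
  rw [← hΛ.conjTranspose, Matrix.conjTranspose_conjTranspose, star_sum] at h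
  rw [h]
  refine Finset.sum_congr rfl fun i _ => ?_
  rw [star_mul', ← hΛ.conjTranspose, Matrix.conjTranspose_conjTranspose]

theorem block_mulRight (hΛ : IsPositiveFunctional (repLin π) Λ) (hbd : IsBoundedFunctional Λ)
    (k₀ k : VecPoint Ω E) {W : NcPoint V} (hW : W ∈ Ω)
    {β : Matrix (Fin k.1.1.size) (Fin W.size) ℂ} (hβ : Intertwines W k.1.1 β)
    (P : Matrix (Fin k₀.1.1.size) (Fin W.size) A) :
    Λ (block k₀ k (mulRight P β.conjTranspose)) =
      Λ (block k₀ ⟨⟨W, hW⟩, act β.conjTranspose k.2⟩ P) := by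
  let l : VecPoint Ω E := ⟨⟨W, hW⟩, act β.conjTranspose k.2⟩
  -- The relation is `β* y - β* y = 0`, its terms transported to `W` from the point of `k` and from
  -- `W` itself.
  have h := hΛ.sum_eq_zero hbd k₀ hW (ι := Bool)
    (fun i => match i with
      | true => k
      | false => l)
    (fun i => match i with
      | true => β
      | false => (-1 : ℂ) • (1 : Matrix (Fin W.size) (Fin W.size) ℂ))
    (fun i => match i with
      | true => hβ
      | false => intertwines_smul_one W (-1))
    (by
      rw [Fintype.sum_bool]
      change act β.conjTranspose k.2 + act ((-1 : ℂ) • (1 : Matrix (Fin W.size) (Fin W.size) ℂ)).conjTranspose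
        (act β.conjTranspose k.2) = 0
      simp only [Matrix.conjTranspose_smul, Matrix.conjTranspose_one, act_smul_one]
      simp) P
  rw [Fintype.sum_bool] at h
  change Λ (block k₀ k (mulRight P β.conjTranspose)) + Λ (block k₀ l
    (mulRight P ((-1 : ℂ) • (1 : Matrix (Fin W.size) (Fin W.size) ℂ)).conjTranspose)) = 0 at h
  rw [Matrix.conjTranspose_smul, Matrix.conjTranspose_one, mulRight_smul_one, map_smul, map_smul,
    star_neg, star_one, neg_one_smul] at h
  exact eq_of_sub_eq_zero (by rw [sub_eq_add_neg]; exact h)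

theorem conjTranspose_mulLeft {a b c : ℕ} (α : Matrix (Fin a) (Fin b) ℂ)
    (P : Matrix (Fin b) (Fin c) A) :
    (mulLeft α P).conjTranspose = mulRight P.conjTranspose α.conjTranspose := by
  ext i j
  simp [mulLeft, mulRight, star_sum]

theorem block_mulLeft (hΛ : IsPositiveFunctional (repLin π) Λ) (hbd : IsBoundedFunctional Λ)
    (k₀ k : VecPoint Ω E) {W : NcPoint V} (hW : W ∈ Ω)
    {α : Matrix (Fin k.1.1.size) (Fin W.size) ℂ} (hα : Intertwines W k.1.1 α)
    (P : Matrix (Fin W.size) (Fin k₀.1.1.size) A) :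
    Λ (block k k₀ (mulLeft α P)) = Λ (block ⟨⟨W, hW⟩, act α.conjTranspose k.2⟩ k₀ P) := by
  rw [← star_star (Λ (block k k₀ _)), ← hΛ.conjTranspose, conjTranspose_mulLeft,
    hΛ.block_mulRight hbd k₀ k hW hα, ← hΛ.conjTranspose, Matrix.conjTranspose_conjTranspose]

theorem norm_block_single_le (hΛ : IsPositiveFunctional (repLin π) Λ) (hbd : IsBoundedFunctional Λ)
    (Z W : Ω) : ∃ C : ℝ, 0 ≤ C ∧ ∀ (r p : Fin Z.1.size) (t q : Fin W.1.size) (T : A) (e f : E),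
      ‖Λ (block ⟨Z, Pi.single p e⟩ ⟨W, Pi.single q f⟩ (Matrix.single r t T))‖ ≤
        C * ‖T‖ * ‖e‖ * ‖f‖ := by
  obtain ⟨C, hC, h⟩ := hΛ.norm_sq_sum_le hbd Z.2 W.2
  refine ⟨√C, Real.sqrt_nonneg C, fun r p t q T e f => ?_⟩
  have := h Unit (Pi.single p e) (fun _ => ⟨W, Pi.single q f⟩) (fun _ => 1)
    (fun _ => intertwines_one W.1) r t T
  simp only [Finset.univ_unique, Finset.sum_singleton, Matrix.conjTranspose_one, mulRight_one,
    act_one, sqNorm_single] at this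
  refine le_of_sq_le_sq ?_ (by positivity)
  refine this.trans (le_of_eq ?_)
  rw [mul_pow, mul_pow, mul_pow, Real.sq_sqrt hC]

theorem exists_clm (hΛ : IsPositiveFunctional (repLin π) Λ) (hbd : IsBoundedFunctional Λ)
    (Z W : Ω) : ∃ G : Matrix (Fin Z.1.size) (Fin W.1.size) A →L[ℂ]
        Matrix (Fin Z.1.size) (Fin W.1.size) (E →L[ℂ] E),
      ∀ P x y, blockForm (G P) x y = Λ (block ⟨Z, x⟩ ⟨W, y⟩ P) := by
  have hsingle_add : ∀ (n : ℕ) (p : Fin n) (e e' : E),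
      (Pi.single p (e + e') : Fin n → E) = ∑ b : Bool, (1 : ℂ) • bif b then Pi.single p e
        else Pi.single p e' := by
    intro n p e e'
    rw [Fintype.sum_bool]
    simp [Pi.single_add]
  have hsingle_smul : ∀ (n : ℕ) (p : Fin n) (c : ℂ) (e : E),
      (Pi.single p (c • e) : Fin n → E) = ∑ _b : Unit, c • Pi.single p e := by
    intro n p c e
    simp [Pi.single_smul]
  obtain ⟨C, hC, hb⟩ := hΛ.norm_block_single_le hbd Z W
  -- For each place `(r, t)` in the argument and `(p, q)` in the value, `Λ` is a bounded trilinear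
  -- form in the entry and two vectors; these forms are the matrix coefficients of the kernel.
  choose G hG using fun (r p : Fin Z.1.size) (t q : Fin W.1.size) =>
    exists_clm_of_trilinear (fun (T : A) (e f : E) =>
      Λ (block ⟨Z, Pi.single p e⟩ ⟨W, Pi.single q f⟩ (Matrix.single r t T)))
      (fun T T' e f => by rw [Matrix.single_add, map_add, map_add])
      (fun c T e f => by rw [← Matrix.smul_single, map_smul, map_smul, smul_eq_mul])
      (fun T e f f' => by
        rw [hsingle_add, hΛ.block_sum_right hbd]
        simp)
      (fun T e c f => by
        rw [hsingle_smul, hΛ.block_sum_right hbd]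
        simp)
      (fun T e e' f => by
        rw [hsingle_add, hΛ.block_sum_left hbd]
        simp)
      (fun T c e f => by
        rw [hsingle_smul, hΛ.block_sum_left hbd]
        simp) hC (hb r p t q)
  let G' : Matrix (Fin Z.1.size) (Fin W.1.size) A →L[ℂ]
      Matrix (Fin Z.1.size) (Fin W.1.size) (E →L[ℂ] E) :=
    { toFun := fun P => Matrix.of fun p q => ∑ r, ∑ t, G r p t q (P r t)
      map_add' := fun P P' => by
        ext1 p q
        simp [Finset.sum_add_distrib]
      map_smul' := fun c P => by
        ext1 p q
        simp [Finset.smul_sum]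
      cont := by
        refine continuous_matrix fun p q => ?_
        change Continuous fun P : Matrix (Fin Z.1.size) (Fin W.1.size) A =>
          ∑ r, ∑ t, G r p t q (P r t)
        exact continuous_finsetSum _ fun r _ => continuous_finsetSum _ fun t _ =>
          (G r p t q).continuous.comp (continuous_id.matrix_elem r t) }
  refine ⟨G', fun P x y => ?_⟩
  have hx : ∀ {n : ℕ} (x : Fin n → E), x = ∑ p, (1 : ℂ) • Pi.single p (x p) := by
    intro n x
    simp only [one_smul]
    exact (Finset.univ_sum_single x).symm
  have h1 : Λ (block ⟨Z, x⟩ ⟨W, y⟩ P) = ∑ p, ∑ q, ∑ r, ∑ t,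
      Λ (block ⟨Z, Pi.single p (x p)⟩ ⟨W, Pi.single q (y q)⟩ (Matrix.single r t (P r t))) := by
    conv_lhs => rw [hx x, hΛ.block_sum_left hbd]
    refine Finset.sum_congr rfl fun p _ => ?_
    rw [star_one, one_mul]
    conv_lhs => rw [hx y, hΛ.block_sum_right hbd]
    refine Finset.sum_congr rfl fun q _ => ?_
    rw [one_mul]
    conv_lhs => rw [Matrix.matrix_eq_sum_single P]
    simp only [map_sum]
  rw [h1, blockForm]
  refine Finset.sum_congr rfl fun p _ => Finset.sum_congr rfl fun q _ => ?_
  change inner ℂ (x p) ((∑ r, ∑ t, G r p t q (P r t)) (y q)) = _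
  simp only [sum_apply, inner_sum, hG]

/-- A positive bounded functional is represented by a completely positive nc kernel. -/
theorem exists_kernel (hΛ : IsPositiveFunctional (repLin π) Λ) (hbd : IsBoundedFunctional Λ) :
    ∃ Γ : GradedKernel V A (E →L[ℂ] E), IsCPNcKernelOn Ω Γ ∧
      ∀ (k l : VecPoint Ω E) (P : Matrix (Fin k.1.1.size) (Fin l.1.1.size) A),
        blockForm (Γ k.1.1 l.1.1 P) k.2 l.2 = Λ (block k l P) := by
  classical
  choose G hG using hΛ.exists_clm hbd
  let Γ : GradedKernel V A (E →L[ℂ] E) := fun Z W =>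
    if h : Z ∈ Ω ∧ W ∈ Ω then G ⟨Z, h.1⟩ ⟨W, h.2⟩ else 0
  have hΓ : ∀ (k l : VecPoint Ω E) (P : Matrix (Fin k.1.1.size) (Fin l.1.1.size) A),
      blockForm (Γ k.1.1 l.1.1 P) k.2 l.2 = Λ (block k l P) := by
    intro k l P
    have : Γ k.1.1 l.1.1 = G k.1 l.1 := dif_pos ⟨k.1.2, l.1.2⟩
    rw [this, hG]
  refine ⟨Γ, ⟨?_, ?_⟩, hΓ⟩
  · intro Z hZ Z' hZ' W hW W' hW' α β hα hβ P
    refine blockForm_ext fun x y => ?_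
    rw [blockForm_mulRight_mulLeft]
    refine (hΓ ⟨⟨Z, hZ⟩, act α.conjTranspose x⟩ ⟨⟨W, hW⟩, act β.conjTranspose y⟩ P).trans
      (Eq.trans ?_ (hΓ ⟨⟨Z', hZ'⟩, x⟩ ⟨⟨W', hW'⟩, y⟩ _).symm)
    rw [hΛ.block_mulRight hbd _ ⟨⟨W', hW'⟩, y⟩ hW hβ,
      hΛ.block_mulLeft hbd _ ⟨⟨Z', hZ'⟩, x⟩ hZ hα]
  · intro n Z hZ a y
    let k : Fin n → VecPoint Ω E := fun i => ⟨⟨Z i, hZ i⟩, y i⟩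
    have h1 : ∑ i, ∑ j, blockForm (Γ (Z i) (Z j) (Matrix.of fun p q => star (a i p) * a j q))
        (y i) (y j) = ∑ i, ∑ j, Λ (block (k i) (k j) (rowProd (a i) (a j))) :=
      Finset.sum_congr rfl fun i _ => Finset.sum_congr rfl fun j _ => hΓ (k i) (k j) _
    rw [h1, Complex.le_def]
    refine ⟨hΛ.re_sum_rowProd_nonneg k a, ?_⟩
    have h2 : star (∑ i, ∑ j, Λ (block (k i) (k j) (rowProd (a i) (a j)))) =
        ∑ i, ∑ j, Λ (block (k i) (k j) (rowProd (a i) (a j))) := by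
      simp only [star_sum, ← hΛ.conjTranspose, rowProd_conjTranspose]
      exact Finset.sum_comm
    exact (Complex.conj_eq_iff_im.1 h2).symm

end IsPositiveFunctional

end Functionals

/-! ### Finite sums over block families and blockwise kernels. -/

section BlockFamilies

variable {V : Type*} {Ω : Set (NcPoint V)} {E : Type*} {A B : Type*} [AddCommGroup A] [Module ℂ A]
  [AddCommGroup B] [Module ℂ B]

theorem BlockFamily.induction {p : BlockFamily Ω E A → Prop} (m : BlockFamily Ω E A) (h0 : p 0)
    (hadd : ∀ m m', p m → p m' → p (m + m')) (hblock : ∀ k l P, p (block k l P)) : p m := by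
  classical
  induction m using DFinsupp.induction with
  | h0 => exact h0
  | ha kl b m _ _ hm =>
    refine hadd _ _ ?_ hm
    have h := hblock kl.1 kl.2 b
    rw [block, DFinsupp.lsingle_apply] at h
    exact h

theorem BlockFamily.lhom_ext {M : Type*} [AddCommGroup M] [Module ℂ M]
    {φ ψ : BlockFamily Ω E A →ₗ[ℂ] M} (h : ∀ k l P, φ (block k l P) = ψ (block k l P)) : φ = ψ :=
  LinearMap.ext fun m => BlockFamily.induction (p := fun m => φ m = ψ m) m (by simp)
    (fun m m' hm hm' => by rw [map_add, map_add, hm, hm']) h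

/-- The same square index set serves every `f`, hence the quadratic forms at all vectors and the
functional `s` at once. -/
theorem exists_blockSum_eq_sum (m : BlockFamily Ω E A) : ∃ s : Finset (VecPoint Ω E),
    ∀ f : ∀ k l : VecPoint Ω E, Matrix (Fin k.1.1.size) (Fin l.1.1.size) A →ₗ[ℂ] ℂ,
      blockSum f m = ∑ k ∈ s, ∑ l ∈ s, f k l (m (k, l)) := by
  classical
  refine ⟨m.support.image Prod.fst ∪ m.support.image Prod.snd, fun f => ?_⟩
  rw [← Finset.sum_product', blockSum, DFinsupp.lsum_apply_apply, DFinsupp.sumAddHom_apply,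
    DFinsupp.sum]
  refine Finset.sum_subset (fun kl hkl => ?_) fun kl _ hkl => ?_
  · exact Finset.mem_product.2 ⟨Finset.mem_union_left _ (Finset.mem_image_of_mem _ hkl),
      Finset.mem_union_right _ (Finset.mem_image_of_mem _ hkl)⟩
  · rw [DFinsupp.notMem_support_iff.1 hkl]
    exact map_zero _

/-- The blockwise application of a kernel. -/
noncomputable def mapBlocks
    (φ : ∀ Z W : NcPoint V, Matrix (Fin Z.size) (Fin W.size) A →ₗ[ℂ]
      Matrix (Fin Z.size) (Fin W.size) B) : BlockFamily Ω E A →ₗ[ℂ] BlockFamily Ω E B :=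
  DFinsupp.mapRange.linearMap fun kl => φ kl.1.1.1 kl.2.1.1

theorem mapBlocks_block
    (φ : ∀ Z W : NcPoint V, Matrix (Fin Z.size) (Fin W.size) A →ₗ[ℂ]
      Matrix (Fin Z.size) (Fin W.size) B) (k l : VecPoint Ω E)
    (P : Matrix (Fin k.1.1.size) (Fin l.1.1.size) A) :
    mapBlocks φ (block k l P) = block k l (φ k.1.1 l.1.1 P) := by
  classical
  exact DFinsupp.mapRange_single (hf := fun _ => map_zero _)

variable {H : Type*} [NormedAddCommGroup H] [InnerProductSpace ℂ H]

theorem quadForm_mapBlocks (π : B →ₗ[ℂ] (H →L[ℂ] H))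
    (φ : ∀ Z W : NcPoint V, Matrix (Fin Z.size) (Fin W.size) A →ₗ[ℂ]
      Matrix (Fin Z.size) (Fin W.size) B) (ν : ∀ k : VecPoint Ω E, Fin k.1.1.size → H)
    (m : BlockFamily Ω E A) :
    quadForm π ν (mapBlocks φ m) =
      blockSum (fun k l => mapBlockForm π (ν k) (ν l) ∘ₗ φ k.1.1 l.1.1) m := by
  refine LinearMap.congr_fun (f := quadForm π ν ∘ₗ mapBlocks φ) (BlockFamily.lhom_ext ?_) m
  intro k l P
  rw [LinearMap.comp_apply, mapBlocks_block, quadForm_block, blockSum_block, LinearMap.comp_apply]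

end BlockFamilies

/-! ### Gram families and the domination theorem. -/

section Main

variable {V : Type*} [AddCommGroup V] [Module ℂ V]
  {E : Type*} [NormedAddCommGroup E] [InnerProductSpace ℂ E] [CompleteSpace E]
  {N : Type*} [NormedAddCommGroup N] [InnerProductSpace ℂ N] [CompleteSpace N]

theorem exists_norm_mapBlockForm_le {A H : Type*} [CStarAlgebra A] [NormedAddCommGroup H]
    [InnerProductSpace ℂ H] [CompleteSpace H] (π : A →⋆ₐ[ℂ] (H →L[ℂ] H)) {n m : ℕ}
    (P : Matrix (Fin n) (Fin m) A) :
    ∃ t : ℝ, 0 ≤ t ∧ ∀ x y, -(t * (sqNorm x + sqNorm y)) ≤ (mapBlockForm (repLin π) x y P).re := by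
  obtain ⟨t, ht, h⟩ := exists_norm_blockForm_le (P.map (repLin π))
  exact ⟨t, ht, fun x y => (abs_le.1 ((Complex.abs_re_le_norm _).trans (h x y))).1⟩

/-- A Gram family `(u i) T (u j)ᴴ` of a matrix `T` along intertwiners. -/
noncomputable def gramFamily {Ω : Set (NcPoint V)} {A : Type*} [AddCommGroup A] [Module ℂ A]
    {n : ℕ} {ι : Type} [Fintype ι] (k : ι → VecPoint Ω E)
    (u : ∀ i, Matrix (Fin (k i).1.1.size) (Fin n) ℂ) (T : Matrix (Fin n) (Fin n) A) :
    BlockFamily Ω E A :=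
  ∑ i, ∑ j, block (k i) (k j) (mulRight (mulLeft (u i) T) (u j).conjTranspose)

/-- Inequalities between matrices at one point thereby transfer to Gram families. -/
theorem quadForm_gramFamily {Ω : Set (NcPoint V)} {A H : Type*} [CStarAlgebra A]
    [NormedAddCommGroup H] [InnerProductSpace ℂ H] [CompleteSpace H] (π : A →⋆ₐ[ℂ] (H →L[ℂ] H))
    (ν : ∀ k : VecPoint Ω E, Fin k.1.1.size → H)
    {n : ℕ} {ι : Type} [Fintype ι] (k : ι → VecPoint Ω E)
    (u : ∀ i, Matrix (Fin (k i).1.1.size) (Fin n) ℂ) (T : Matrix (Fin n) (Fin n) A) :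
    quadForm (repLin π) ν (gramFamily k u T) = mapBlockForm (repLin π)
      (∑ i, act (u i).conjTranspose (ν (k i))) (∑ i, act (u i).conjTranspose (ν (k i))) T := by
  simp only [gramFamily, map_sum, quadForm_block, mapBlockForm_mulRight_mulLeft]
  rw [mapBlockForm_apply, blockForm_sum_left]
  simp only [blockForm_sum_right]
  rfl

theorem IsPositiveFunctional.re_gramFamily_nonneg {Ω : Set (NcPoint V)} {A H : Type*}
    [CStarAlgebra A] [NormedAddCommGroup H] [InnerProductSpace ℂ H] [CompleteSpace H]
    {π : A →⋆ₐ[ℂ] (H →L[ℂ] H)} {Λ : BlockFamily Ω E A →ₗ[ℂ] ℂ}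
    (hΛ : IsPositiveFunctional (repLin π) Λ) {n : ℕ} {ι : Type} [Fintype ι] (k : ι → VecPoint Ω E)
    (u : ∀ i, Matrix (Fin (k i).1.1.size) (Fin n) ℂ) : 0 ≤ (Λ (gramFamily k u 1)).re :=
  hΛ _ fun ν => by
    rw [quadForm_gramFamily, mapBlockForm_one, Complex.ofReal_re]
    exact sqNorm_nonneg _

theorem IsNcKernelOn.mapBlocks_gramFamily {Ω : Set (NcPoint V)} {B : Type*} [CStarAlgebra B]
    {K : GradedKernel V ℂ B} (hK : IsNcKernelOn Ω K) {W : NcPoint V} (hW : W ∈ Ω) {ι : Type}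
    [Fintype ι] (k : ι → VecPoint Ω E) (u : ∀ i, Matrix (Fin (k i).1.1.size) (Fin W.size) ℂ)
    (hu : ∀ i, Intertwines W (k i).1.1 (u i)) (T : Matrix (Fin W.size) (Fin W.size) ℂ) :
    mapBlocks (fun Z W => (K Z W).toLinearMap) (gramFamily k u T) = gramFamily k u (K W W T) := by
  simp only [gramFamily, map_sum, mapBlocks_block]
  refine Finset.sum_congr rfl fun i _ => Finset.sum_congr rfl fun j _ => ?_
  congr 1
  exact (hK W hW _ (k i).1.2 W hW _ (k j).1.2 _ _ (hu i) (hu j) T).symm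

theorem IsNcKernelOn.mono {Ω Ω' : Set (NcPoint V)} {A B : Type*} [CStarAlgebra A] [CStarAlgebra B]
    {K : GradedKernel V A B} (hK : IsNcKernelOn Ω' K) (h : Ω ⊆ Ω') : IsNcKernelOn Ω K :=
  fun Z hZ Z' hZ' W hW W' hW' => hK Z (h hZ) Z' (h hZ') W (h hW) W' (h hW')

theorem exists_kernel_domination (Ξ : Set (NcPoint V)) (hΞ : IsFullNcSet Ξ)
    (Q : GradedKernel V ℂ (N →L[ℂ] N)) (hQ : IsNcKernelOn Ξ Q) (hQherm : IsHermitianOn Ξ Q)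
    (Ω : Set (NcPoint V)) (hΩ : Ω ⊆ strictPosDomain Ξ Q) (Ω' : Set (NcPoint V))
    (hΩ' : Ω' = fullEnvelope Ω ∩ strictPosDomain Ξ Q)
    (S : GradedKernel V ℂ (E →L[ℂ] E)) (hS : IsNcKernelOn Ω' S) (hSherm : IsHermitianOn Ω' S)
    (hSpos : ∀ Z ∈ Ω', BlockNonneg (S Z Z 1)) :
    ∃ (Γ₁ : GradedKernel V (N →L[ℂ] N) (E →L[ℂ] E)) (Γ₂ : GradedKernel V ℂ (E →L[ℂ] E)),
      IsCPNcKernelOn Ω Γ₁ ∧ IsCPNcKernelOn Ω Γ₂ ∧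
        ∀ Z ∈ Ω, ∀ W ∈ Ω, ∀ P : Matrix (Fin Z.size) (Fin W.size) ℂ,
          S Z W P = Γ₁ Z W (Q Z W P) + Γ₂ Z W P := by
  have hΩΩ' : Ω ⊆ Ω' := fun Z hZ => hΩ' ▸ ⟨subset_fullEnvelope Ω hZ, hΩ hZ⟩
  have hQΩ : IsNcKernelOn Ω Q := hQ.mono fun Z hZ => (hΩ hZ).1
  have hSΩ : IsNcKernelOn Ω S := hS.mono hΩΩ'
  let π := StarAlgHom.id ℂ (N →L[ℂ] N)
  let ρ := StarAlgHom.ofId ℂ (ℂ →L[ℂ] ℂ)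
  let q : BlockFamily Ω E ℂ →ₗ[ℂ] BlockFamily Ω E (N →L[ℂ] N) :=
    mapBlocks fun Z W => (Q Z W).toLinearMap
  let s : BlockFamily Ω E ℂ →ₗ[ℂ] ℂ :=
    quadForm (repLin (StarAlgHom.id ℂ (E →L[ℂ] E))) (fun k => k.2) ∘ₗ
      mapBlocks fun Z W => (S Z W).toLinearMap
  choose ε hε hεle using fun k : VecPoint Ω E => (hΩ k.1.2).2.exists_re
  obtain ⟨Λ₁, Λ₂, hΛ, hΛ₁, hΛ₂⟩ := exists_positive_decomposition
    (fun ν : ∀ k : VecPoint Ω E, Fin k.1.1.size → N => quadForm (repLin π) ν)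
    (fun ν : ∀ k : VecPoint Ω E, Fin k.1.1.size → ℂ => quadForm (repLin ρ) ν) q s
    (by
      intro m hQm hm
      obtain ⟨t, ht⟩ := exists_blockSum_eq_sum m
      have := re_sum_blockForm_nonneg hΞ hQ hQherm hΩ hΩ' hS hSherm hSpos t (fun k => k.1.1)
        (fun k => k.1.2) (fun k l => m (k, l)) (fun ν => by
          have := hm ν
          rw [quadForm, ht] at this
          exact this) (fun ν => by
          have := hQm ν
          rw [quadForm_mapBlocks, ht] at this
          exact this) fun k => k.2
      change 0 ≤ (quadForm _ _ _).re
      rw [quadForm_mapBlocks, ht]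
      exact this)
    (by
      intro x
      induction x using BlockFamily.induction with
      | h0 => exact ⟨0, by simp⟩
      | hadd m m' hm hm' =>
        obtain ⟨y, h1, h2⟩ := hm
        obtain ⟨y', h1', h2'⟩ := hm'
        refine ⟨y + y', fun ν => ?_, fun ν => ?_⟩
        · have := add_nonneg (h1 ν) (h1' ν)
          rwa [← Complex.add_re, ← map_add, add_add_add_comm, ← map_add q] at this
        · rw [map_add, Complex.add_re]
          exact add_nonneg (h2 ν) (h2' ν)
      | hblock k l P =>
        obtain ⟨t, ht, hP⟩ := exists_norm_mapBlockForm_le π P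
        -- The form of `P` is at least `-t (‖ν_k‖² + ‖ν_l‖²)`, while `Q` sends the identity at `k`
        -- to something at least `ε k`; the weights `t / ε k` and `t / ε l` compensate exactly.
        refine ⟨((t / ε k : ℝ) : ℂ) • block k k (1 : Matrix _ _ ℂ) + ((t / ε l : ℝ) : ℂ) • block l l (1 : Matrix _ _ ℂ),
          fun ν => ?_, fun ν => ?_⟩
        · simp only [q, map_add, map_smul, mapBlocks_block, quadForm_block, smul_eq_mul,
            Complex.add_re, Complex.re_ofReal_mul]
          have h1 := mul_le_mul_of_nonneg_left (hεle k (ν k)) (div_nonneg ht (hε k).le)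
          have h2 := mul_le_mul_of_nonneg_left (hεle l (ν l)) (div_nonneg ht (hε l).le)
          rw [← mul_assoc, div_mul_cancel₀ _ (hε k).ne'] at h1
          rw [← mul_assoc, div_mul_cancel₀ _ (hε l).ne'] at h2
          have h3 := hP (ν k) (ν l)
          change 0 ≤ t / ε k * (blockForm (Q k.1.1 k.1.1 1) (ν k) (ν k)).re +
            t / ε l * (blockForm (Q l.1.1 l.1.1 1) (ν l) (ν l)).re +
            (mapBlockForm (repLin π) (ν k) (ν l) P).re
          linarith
        · simp only [map_add, map_smul, quadForm_block, smul_eq_mul, mapBlockForm_one,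
            Complex.add_re, Complex.re_ofReal_mul, Complex.ofReal_re]
          exact add_nonneg (mul_nonneg (div_nonneg ht (hε k).le) (sqNorm_nonneg _))
            (mul_nonneg (div_nonneg ht (hε l).le) (sqNorm_nonneg _)))
    (by
      intro z
      induction z using BlockFamily.induction with
      | h0 => exact ⟨0, by simp⟩
      | hadd m m' hm hm' =>
        obtain ⟨y, h1, h2⟩ := hm
        obtain ⟨y', h1', h2'⟩ := hm'
        refine ⟨y + y', fun ν => ?_, fun ν => ?_⟩
        · rw [map_add, map_add, Complex.add_re]
          exact add_nonneg (h1 ν) (h1' ν)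
        · have := add_nonneg (h2 ν) (h2' ν)
          rwa [← Complex.add_re, ← map_add, add_add_add_comm] at this
      | hblock k l P =>
        obtain ⟨t, ht, hP⟩ := exists_norm_mapBlockForm_le ρ P
        refine ⟨(t : ℂ) • block k k (1 : Matrix _ _ ℂ) + (t : ℂ) • block l l (1 : Matrix _ _ ℂ), fun ν => ?_, fun ν => ?_⟩
        · simp only [q, map_add, map_smul, mapBlocks_block, quadForm_block, smul_eq_mul,
            Complex.add_re, Complex.re_ofReal_mul]
          exact add_nonneg
            (mul_nonneg ht ((mul_nonneg (hε k).le (sqNorm_nonneg _)).trans (hεle k (ν k))))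
            (mul_nonneg ht ((mul_nonneg (hε l).le (sqNorm_nonneg _)).trans (hεle l (ν l))))
        · simp only [map_add, map_smul, quadForm_block, smul_eq_mul, mapBlockForm_one,
            Complex.add_re, Complex.re_ofReal_mul, Complex.ofReal_re]
          linarith [hP (ν k) (ν l)])
  have hs : ∀ W ∈ Ω, ∃ C : ℝ, 0 ≤ C ∧ ∀ (ι : Type) [Fintype ι] (k : ι → VecPoint Ω E)
      (u : ∀ i, Matrix (Fin (k i).1.1.size) (Fin W.size) ℂ),
      (∀ i, Intertwines W (k i).1.1 (u i)) →
        (s (gramFamily k u 1)).re ≤ C * sqNorm (∑ i, act (u i).conjTranspose (k i).2) := by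
    intro W hW
    obtain ⟨t, ht, h⟩ := exists_norm_blockForm_le (S W W 1)
    refine ⟨2 * t, by positivity, fun ι _ k u hu => ?_⟩
    change (quadForm _ _ _).re ≤ _
    rw [hSΩ.mapBlocks_gramFamily hW k u hu, quadForm_gramFamily]
    refine (Complex.re_le_norm _).trans ((h _ _).trans (le_of_eq ?_))
    ring
  -- As a kernel, `Q` maps the Gram family of `1` to that of `Q(W, W)(1) ⪰ e I`; positivity of `Λ₁`
  -- gives the comparison.
  have hΛ₁q : ∀ W ∈ Ω, ∃ e : ℝ, 0 < e ∧ ∀ (ι : Type) [Fintype ι] (k : ι → VecPoint Ω E)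
      (u : ∀ i, Matrix (Fin (k i).1.1.size) (Fin W.size) ℂ),
      (∀ i, Intertwines W (k i).1.1 (u i)) →
        e * (Λ₁ (gramFamily k u 1)).re ≤ (Λ₁ (q (gramFamily k u 1))).re := by
    intro W hW
    obtain ⟨e, he, hle⟩ := (hΩ hW).2.exists_re
    refine ⟨e, he, fun ι _ k u hu => ?_⟩
    have h := hΛ₁ (q (gramFamily k u 1) - (e : ℂ) • gramFamily k u
      (1 : Matrix (Fin W.size) (Fin W.size) (N →L[ℂ] N))) fun ν => by
      rw [hQΩ.mapBlocks_gramFamily hW k u hu, map_sub, map_smul, quadForm_gramFamily,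
        quadForm_gramFamily, mapBlockForm_one, smul_eq_mul, Complex.sub_re,
        Complex.re_ofReal_mul, Complex.ofReal_re]
      exact sub_nonneg.2 (hle _)
    rw [map_sub, map_smul, smul_eq_mul, Complex.sub_re, Complex.re_ofReal_mul] at h
    linarith
  have hΛre : ∀ m, (Λ₁ (q m)).re + (Λ₂ m).re = (s m).re := fun m => by
    rw [← Complex.add_re, hΛ]
  have hpos₁ : IsPositiveFunctional (repLin π) Λ₁ := hΛ₁
  have hpos₂ : IsPositiveFunctional (repLin ρ) Λ₂ := hΛ₂
  -- On Gram families `e Λ₁ ≤ Λ₁ ∘ q = s - Λ₂ ≤ s` in real parts, and `s` is bounded. For `Λ₂` the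
  -- positive term `Λ₁ ∘ q` is discarded instead.
  have hbd₁ : IsBoundedFunctional Λ₁ := by
    intro W hW
    obtain ⟨C, hC, h⟩ := hs W hW
    obtain ⟨e, he, hle⟩ := hΛ₁q W hW
    refine ⟨C / e, by positivity, fun ι _ k u hu => ?_⟩
    change (Λ₁ (gramFamily k u 1)).re ≤ _
    rw [div_mul_eq_mul_div, le_div_iff₀ he]
    linarith [h ι k u hu, hle ι k u hu, hΛre (gramFamily k u 1), hpos₂.re_gramFamily_nonneg k u]
  have hbd₂ : IsBoundedFunctional Λ₂ := by
    intro W hW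
    obtain ⟨C, hC, h⟩ := hs W hW
    obtain ⟨e, he, hle⟩ := hΛ₁q W hW
    refine ⟨C, hC, fun ι _ k u hu => ?_⟩
    change (Λ₂ (gramFamily k u 1)).re ≤ _
    linarith [h ι k u hu, hle ι k u hu, hΛre (gramFamily k u 1),
      mul_nonneg he.le (hpos₁.re_gramFamily_nonneg k u)]
  obtain ⟨Γ₁, hΓ₁, hΓ₁eq⟩ := hpos₁.exists_kernel hbd₁
  obtain ⟨Γ₂, hΓ₂, hΓ₂eq⟩ := hpos₂.exists_kernel hbd₂
  refine ⟨Γ₁, Γ₂, hΓ₁, hΓ₂, fun Z hZ W hW P => blockForm_ext fun x y => ?_⟩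
  have h1 := hΓ₁eq ⟨⟨Z, hZ⟩, x⟩ ⟨⟨W, hW⟩, y⟩ (Q Z W P)
  have h2 := hΓ₂eq ⟨⟨Z, hZ⟩, x⟩ ⟨⟨W, hW⟩, y⟩ P
  have h3 := hΛ (block ⟨⟨Z, hZ⟩, x⟩ ⟨⟨W, hW⟩, y⟩ P)
  have h4 : s (block ⟨⟨Z, hZ⟩, x⟩ ⟨⟨W, hW⟩, y⟩ P) = blockForm (S Z W P) x y :=
    (congrArg _ (mapBlocks_block _ _ _ _)).trans (quadForm_block _ _ _ _ _)
  have h5 : q (block ⟨⟨Z, hZ⟩, x⟩ ⟨⟨W, hW⟩, y⟩ P) =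
      block ⟨⟨Z, hZ⟩, x⟩ ⟨⟨W, hW⟩, y⟩ (Q Z W P) := mapBlocks_block _ _ _ _
  rw [h4, h5, ← h1, ← h2] at h3
  rw [blockForm_add]
  exact h3.symm

end Main

end NCKernel

theorem theorem5p1
    {V : Type*} [AddCommGroup V] [Module ℂ V]
    {E : Type*} [NormedAddCommGroup E] [InnerProductSpace ℂ E] [CompleteSpace E]
    {N : Type*} [NormedAddCommGroup N] [InnerProductSpace ℂ N] [CompleteSpace N]
    (Ξ : Set (NCKernel.NcPoint V)) (hΞ : NCKernel.IsFullNcSet Ξ)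
    (Q : NCKernel.GradedKernel V ℂ (N →L[ℂ] N))
    (hQ : NCKernel.IsNcKernelOn Ξ Q) (hQherm : NCKernel.IsHermitianOn Ξ Q)
    (Ω : Set (NCKernel.NcPoint V)) (hΩ : Ω ⊆ NCKernel.strictPosDomain Ξ Q)
    (Ω' : Set (NCKernel.NcPoint V))
    (hΩ' : Ω' = NCKernel.fullEnvelope Ω ∩ NCKernel.strictPosDomain Ξ Q)
    (S : NCKernel.GradedKernel V ℂ (E →L[ℂ] E))
    (hS : NCKernel.IsNcKernelOn Ω' S) (hSherm : NCKernel.IsHermitianOn Ω' S)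
    (hSpos : ∀ Z ∈ Ω', NCKernel.BlockNonneg (S Z Z 1))
    (hQdec : ∀ F : Set (NCKernel.NcPoint V), F.Finite → F ⊆ Ξ → NCKernel.IsDecomposableOn F Q)
    (hSdec : ∀ F : Set (NCKernel.NcPoint V), F.Finite → F ⊆ Ω' → NCKernel.IsDecomposableOn F S) :
    ∃ (Γ₁ : NCKernel.GradedKernel V (N →L[ℂ] N) (E →L[ℂ] E))
      (Γ₂ : NCKernel.GradedKernel V ℂ (E →L[ℂ] E)),
      NCKernel.IsCPNcKernelOn Ω Γ₁ ∧ NCKernel.IsCPNcKernelOn Ω Γ₂ ∧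
        ∀ Z ∈ Ω, ∀ W ∈ Ω, ∀ P : Matrix (Fin Z.size) (Fin W.size) ℂ,
          S Z W P = Γ₁ Z W (Q Z W P) + Γ₂ Z W P :=
  NCKernel.exists_kernel_domination Ξ hΞ Q hQ hQherm Ω hΩ Ω' hΩ' S hS hSherm hSpos
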